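/- Let $\mathcal H_0,\mathcal H_1$ be complex Hilbert spaces, $A_0$, $A_1$ (possibly unbounded) selfadjoint operators in $\mathcal H_0$, $\mathcal H_1$, and let $B_{01}:\mathcal H_1\to\mathcal H_0$ be bounded, $B_{10}=B_{01}^*$. Let $J=(\mu^{(1)},\mu^{(2)})$, $-\infty\le\mu^{(1)}<\mu^{(2)}\le\infty$. Suppose that $\sigma(A_0)=\overline J$, that the spectrum of $A_0$ is absolutely continuous (i.e. $\langle E_0(\cdot)x,x\rangle$ is absolutely continuous with respect to Lebesgue measure for every $x\in\mathcal H_0$, $E_0$ being the spectral measure of $A_0$), and that $\sigma(A_1)\subset J$. Let $D^-$ be a simply connected domain in the open lower half-plane adjacent to $J$: every $x\in J$ has a disc around it whose lower half is contained in $D^-$. Let $D^+$ be the mirror image of $D^-$ in the real axis. Put $K_B(\mu)=B_{10}E_0((-\infty,\mu))B_{01}$. Suppose that $K_B$ is differentiable on $J$ in operator norm and that $K_B'$ extends to a function continuous on $D^-\cup\overline J$ and holomorphic in $D^-$, which, if $J$ is unbounded, is bounded on $\{\mu\in D^-:|\mu|>R\}$ for some $R$. Put $K_B'(\bar\mu)=K_B'(\mu)^*$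 for $\mu\in D^-$, which continues $K_B'$ to $D^+$. Fix $l\in\{1,-1\}$. A contour $\Gamma^l$ is a Jordan arc in $D^l$ (end points excluded), parametrized by arc length, that results from $J$, traversed from left to right, by a continuous deformation through curves in $D^l$, tending at both ends, uniformly in the deformation parameter, to the end points of $J$ (to $\infty$ where $J$ is unbounded); it has finite length near each finite end point of $J$. Put $$\mathcal V_0(B,\Gamma^l)=\int_{\Gamma^l}|d\mu|\,\|K_B'(\mu)\|,\qquad d_0(\Gamma^l)=\operatorname{dist}\{\sigma(A_1),\Gamma^l\}.$$ Call $\Gamma^l$ admissible if $\mathcal V_0(B,\Gamma^l)<\infty$ and $\mathcal V_0(B,\Gamma^l)<\tfrac14 d_0(\Gamma^l)^2$, and for such contours put $$r_{\min}(\Gamma^l)=\tfrac12 d_0(\Gamma^l)-\sqrt{\tfrac14 d_0(\Gamma^l)^2-\mathcal V_0(B,\Gamma^l)},\qquad r_0(B)=\inf_{\Gamma^l\ \text{admissible}} r_{\min}(\Gamma^l).$$ For $z\in\mathbb C\setminus\overline{\Gamma^l}$ let $$M_1(z,\Gamma^l)=A_1-z+\int_{\Gamma^l}d\mu\,K_B'(\mu)(z-\mu)^{-1}$$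 be the continued transfer function; its spectrum is the set of all $z\in\mathbb C\setminus\overline{\Gamma^l}$ for which $M_1(z,\Gamma^l)$ has no bounded inverse. Theorem. Assume that at least one admissible contour $\Gamma^l$ exists. Then there is a bounded operator $X^{(l)}$ in $\mathcal H_1$ which, for every admissible $\Gamma^l$, is the unique solution of $$X=\int_{\Gamma^l}d\mu\,K_B'(\mu)(A_1+X-\mu)^{-1}\quad\text{with}\quad \|X\|\le r_{\min}(\Gamma^l).$$ For $H_1^{(l)}=A_1+X^{(l)}$ the following hold. (i) $\sigma(H_1^{(l)})\subset\{z\in\mathbb C:\operatorname{dist}\{z,\sigma(A_1)\}\le r_0(B)\}$. (ii) For every admissible $\Gamma^l$, the part of the spectrum of $M_1(\cdot,\Gamma^l)$ lying in $\{z\in\mathbb C:\operatorname{dist}\{z,\sigma(A_1)\}\le \tfrac12 d_0(\Gamma^l)\}$, non-real points (in particular resonances) included, is exactly $\sigma(H_1^{(l)})$. -/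

import Mathlib

open Set Filter Topology MeasureTheory

namespace OperatorRoot

noncomputable section

/-! ### Unbounded operators: resolvent and spectrum -/

section Operators

variable {H : Type*} [NormedAddCommGroup H] [InnerProductSpace ℂ H]

/-- `R` is a bounded everywhere defined two-sided inverse of `T - z`. -/
def IsResolventAt (T : H →ₗ.[ℂ] H) (z : ℂ) (R : H →L[ℂ] H) : Prop :=
  (∀ x : H, ∃ hx : R x ∈ T.domain, T ⟨R x, hx⟩ - z • R x = x) ∧
    ∀ x : T.domain, R (T x - z • (x : H)) = x

/-- The spectrum of a (possibly unbounded) operator `T`. -/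
def spec (T : H →ₗ.[ℂ] H) : Set ℂ := {z | ¬ ∃ R : H →L[ℂ] H, IsResolventAt T z R}

open Classical in
/-- The resolvent `(T - z)⁻¹`; it is `0` by convention when `z` is in the spectrum of `T`. -/
def resolventOp (T : H →ₗ.[ℂ] H) (z : ℂ) : H →L[ℂ] H :=
  if h : ∃ R : H →L[ℂ] H, IsResolventAt T z R then h.choose else 0

/-- The sum `A + X` of an unbounded operator and a bounded one, with the domain of `A`. -/
def addBounded (A : H →ₗ.[ℂ] H) (X : H →L[ℂ] H) : H →ₗ.[ℂ] H :=
  (X : H →ₗ[ℂ] H) +ᵥ A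

end Operators

/-! ### Spectral measures -/

/-- A projection-valued measure on the Borel sets of `ℝ` (countably additive in the strong
operator topology, with total mass the identity). -/
structure ProjMeasure (H : Type*) [NormedAddCommGroup H] [InnerProductSpace ℂ H]
    [CompleteSpace H] where
  proj : Set ℝ → H →L[ℂ] H
  isStarProjection : ∀ s, MeasurableSet s → IsStarProjection (proj s)
  univ_eq : proj univ = 1
  iUnion_hasSum : ∀ s : ℕ → Set ℝ, (∀ n, MeasurableSet (s n)) →
    Pairwise (Function.onFun Disjoint s) → ∀ x : H,
      HasSum (fun n => proj (s n) x) (proj (⋃ n, s n) x)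

section Spectral

variable {H : Type*} [NormedAddCommGroup H] [InnerProductSpace ℂ H] [CompleteSpace H]

theorem norm_sq_eq_of_isStarProjection {P : H →L[ℂ] H} (hP : IsStarProjection P) (x : H) :
    ‖P x‖ ^ 2 = RCLike.re (inner ℂ x (P x)) := by
  have h1 : P (P x) = P x := by
    have := hP.isIdempotentElem
    exact congrArg (fun T : H →L[ℂ] H => T x) this
  have h2 : ContinuousLinearMap.adjoint P = P := hP.isSelfAdjoint
  rw [← inner_self_eq_norm_sq (𝕜 := ℂ)]
  congr 1
  calc inner ℂ (P x) (P x) = inner ℂ x (ContinuousLinearMap.adjoint P (P x)) := by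
        rw [ContinuousLinearMap.adjoint_inner_right]
    _ = inner ℂ x (P x) := by rw [h2, h1]

theorem ProjMeasure.empty_apply (E : ProjMeasure H) (x : H) : E.proj ∅ x = 0 := by
  have h := E.iUnion_hasSum (fun _ => (∅ : Set ℝ)) (fun _ => MeasurableSet.empty)
    (fun _ _ _ => by simp [Function.onFun]) x
  have h0 := h.summable.tendsto_atTop_zero
  exact tendsto_nhds_unique tendsto_const_nhds h0

theorem ProjMeasure.iUnion_norm_sq (E : ProjMeasure H) (x : H) (s : ℕ → Set ℝ)
    (hs : ∀ n, MeasurableSet (s n)) (hd : Pairwise (Function.onFun Disjoint s)) :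
    ENNReal.ofReal (‖E.proj (⋃ n, s n) x‖ ^ 2)
      = ∑' n, ENNReal.ofReal (‖E.proj (s n) x‖ ^ 2) := by
  have h := E.iUnion_hasSum s hs hd x
  have h2 : HasSum (fun n => ‖E.proj (s n) x‖ ^ 2) (‖E.proj (⋃ n, s n) x‖ ^ 2) := by
    rw [norm_sq_eq_of_isStarProjection (E.isStarProjection _ (MeasurableSet.iUnion hs))]
    simp_rw [fun n => norm_sq_eq_of_isStarProjection (E.isStarProjection (s n) (hs n)) x]
    have h3 := h.mapL (innerSL ℂ x)
    exact h3.mapL (RCLike.reCLM (K := ℂ))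
  rw [← h2.tsum_eq, ENNReal.ofReal_tsum_of_nonneg (fun n => by positivity) h2.summable]

/-- The scalar measure `s ↦ ‖E(s) x‖² = ⟨E(s) x, x⟩`. -/
def ProjMeasure.diag (E : ProjMeasure H) (x : H) : Measure ℝ :=
  Measure.ofMeasurable (fun s _ => ENNReal.ofReal (‖E.proj s x‖ ^ 2))
    (by simp [E.empty_apply x])
    (fun s hs hd => E.iUnion_norm_sq x s hs hd)

/-- `E` is the spectral measure of `A`, i.e. `A = ∫ t dE(t)`: the domain of `A` consists of the
`x` with `∫ t² d⟨E(t)x,x⟩ < ∞`, and `⟨x, A x⟩ = ∫ t d⟨E(t)x,x⟩` on it (which determines `A x` by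
polarization). -/
def ProjMeasure.IsSpectralMeasureOf (E : ProjMeasure H) (A : H →ₗ.[ℂ] H) : Prop :=
  (∀ x : H, x ∈ A.domain ↔ Integrable (fun t : ℝ => t ^ 2) (E.diag x)) ∧
    ∀ x : A.domain, inner ℂ (x : H) (A x) = ((∫ t : ℝ, t ∂(E.diag (x : H)) : ℝ) : ℂ)

end Spectral

/-! ### Intervals with possibly infinite ends -/

/-- The open interval `(a, b)` of the real line, `-∞ ≤ a`, `b ≤ ∞`. -/
def ioo (a b : EReal) : Set ℝ := {t : ℝ | a < (t : EReal) ∧ (t : EReal) < b}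

/-- Real parameters tending to the left end `a` of an interval from inside. -/
def leftEnd (a : EReal) : Filter ℝ := comap Real.toEReal (𝓝[>] a)

/-- Real parameters tending to the right end `b` of an interval from inside. -/
def rightEnd (b : EReal) : Filter ℝ := comap Real.toEReal (𝓝[<] b)

open Classical in
/-- Neighbourhoods in `ℂ` of an end `p ∈ [-∞, ∞]`; an infinite end is the point `∞` of `ℂ`. -/
def endNhds (p : EReal) : Filter ℂ :=
  if p = ⊥ ∨ p = ⊤ then Bornology.cobounded ℂ else 𝓝 ((p.toReal : ℝ) : ℂ)

/-! ### The domains of continuation and the continued density -/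

/-- `D` is a simply connected domain in the open lower half-plane adjacent to the interval
`J = (μ₁, μ₂)`: every point of `J` has a neighbourhood whose lower half is contained in `D`
(so that `J` is part of the boundary of `D`, reached from below). -/
structure IsLowerDomain (μ₁ μ₂ : EReal) (D : Set ℂ) : Prop where
  isOpen : IsOpen D
  isSimplyConnected : IsSimplyConnected D
  im_neg : ∀ μ ∈ D, μ.im < 0
  adjacent : ∀ x ∈ ioo μ₁ μ₂, ∃ ε > 0, ∀ μ : ℂ, ‖μ - (x : ℂ)‖ < ε → μ.im < 0 → μ ∈ D

/-- `D^l` for `l = ±1`: `D^{-1} = D` and `D^{+1}` is its mirror image in the real axis. -/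
def sheet (D : Set ℂ) (l : ℤˣ) : Set ℂ :=
  if l = 1 then {μ : ℂ | (starRingEnd ℂ) μ ∈ D} else D

section Density

variable {H₀ H₁ : Type*}
  [NormedAddCommGroup H₀] [InnerProductSpace ℂ H₀] [CompleteSpace H₀]
  [NormedAddCommGroup H₁] [InnerProductSpace ℂ H₁] [CompleteSpace H₁]

/-- `K_B(μ) = B₁₀ E((-∞, μ)) B₀₁` with `B₀₁ = B` and `B₁₀ = B*`. -/
def couplingMeasure (B : H₁ →L[ℂ] H₀) (E : ProjMeasure H₀) (μ : ℝ) : H₁ →L[ℂ] H₁ :=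
  (ContinuousLinearMap.adjoint B) ∘L (E.proj (Iio μ)) ∘L B

/-- `K` is the derivative `K'_B` of `K_B` on the interval `J = (μ₁, μ₂)` together with its analytic
continuation to `D` and, by reflection, to the mirror image of `D`. The continuation is continuous
up to the closed interval; if the interval is unbounded, this means at its infinite ends that the
continuation stays bounded there. -/
structure IsContinuedDerivative (KB : ℝ → H₁ →L[ℂ] H₁) (μ₁ μ₂ : EReal) (D : Set ℂ)
    (K : ℂ → H₁ →L[ℂ] H₁) : Prop where
  hasDerivAt : ∀ x ∈ ioo μ₁ μ₂, HasDerivAt KB (K (x : ℂ)) x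
  continuousOn : ContinuousOn K (D ∪ Complex.ofReal '' closure (ioo μ₁ μ₂))
  differentiableOn : DifferentiableOn ℂ K D
  conj_eq : ∀ μ ∈ D, K ((starRingEnd ℂ) μ) = ContinuousLinearMap.adjoint (K μ)
  bounded_at_infinity : μ₁ = ⊥ ∨ μ₂ = ⊤ →
    K =O[Bornology.cobounded ℂ ⊓ 𝓟 D] (fun _ => (1 : ℝ))

end Density

/-! ### Contours -/

/-- A locally rectifiable Jordan arc in `ℂ`, parametrized by arc length on the open interval
`(lo, hi)`; its ends are not included. -/
structure Arc where
  lo : EReal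
  hi : EReal
  lo_lt_hi : lo < hi
  path : ℝ → ℂ
  unitSpeed : HasUnitSpeedOn path (ioo lo hi)
  injOn : InjOn path (ioo lo hi)

namespace Arc

/-- The parameter interval. -/
def dom (Γ : Arc) : Set ℝ := ioo Γ.lo Γ.hi

/-- The set of points of the arc. -/
def range (Γ : Arc) : Set ℂ := Γ.path '' Γ.dom

/-- `Γ` lies in `D` and results from the interval `J = (μ₁, μ₂)` (traversed from left to right) by
a continuous deformation `h` inside `D` with fixed ends; near finite ends `Γ` has finite length. -/
structure IsDeformation (Γ : Arc) (μ₁ μ₂ : EReal) (D : Set ℂ) : Prop where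
  finite_lo : μ₁ ≠ ⊥ → Γ.lo ≠ ⊥
  finite_hi : μ₂ ≠ ⊤ → Γ.hi ≠ ⊤
  exists_homotopy : ∃ h : ℝ → ℝ → ℂ,
    ContinuousOn (Function.uncurry h) (Icc 0 1 ×ˢ Γ.dom) ∧
    (∃ j : ℝ → ℝ, StrictMonoOn j Γ.dom ∧ j '' Γ.dom = ioo μ₁ μ₂ ∧
      ∀ t ∈ Γ.dom, h 0 t = (j t : ℂ)) ∧
    (∀ t ∈ Γ.dom, h 1 t = Γ.path t) ∧
    (∀ s ∈ Ioc (0 : ℝ) 1, ∀ t ∈ Γ.dom, h s t ∈ D) ∧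
    Tendsto (Function.uncurry h) (𝓟 (Icc 0 1) ×ˢ leftEnd Γ.lo) (endNhds μ₁) ∧
    Tendsto (Function.uncurry h) (𝓟 (Icc 0 1) ×ˢ rightEnd Γ.hi) (endNhds μ₂)

variable {H : Type*} [NormedAddCommGroup H] [InnerProductSpace ℂ H]

/-- The contour integral `∫_Γ F(μ) dμ`. -/
def integral (Γ : Arc) (F : ℂ → H →L[ℂ] H) : H →L[ℂ] H :=
  ∫ t in Γ.dom, deriv Γ.path t • F (Γ.path t)

/-- The variation `𝒱₀(B, Γ) = ∫_Γ |dμ| ‖K'_B(μ)‖`, as an extended nonnegative number. -/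
def eVariation (Γ : Arc) (K : ℂ → H →L[ℂ] H) : ENNReal :=
  ∫⁻ t in Γ.dom, ‖K (Γ.path t)‖ₑ

/-- The variation `𝒱₀(B, Γ)` as a real number (meaningful for `K_B`-bounded contours). -/
def variation (Γ : Arc) (K : ℂ → H →L[ℂ] H) : ℝ := (Γ.eVariation K).toReal

/-- `d₀(Γ) = dist (σ(A), Γ)`. -/
def d₀ (Γ : Arc) (A : H →ₗ.[ℂ] H) : ℝ :=
  sInf {r : ℝ | ∃ z ∈ spec A, ∃ μ ∈ Γ.range, r = dist z μ}

/-- `Γ` is `K_B`-bounded and `𝒱₀(B, Γ) < d₀(Γ)² / 4`. -/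
def SmallVariation (Γ : Arc) (A : H →ₗ.[ℂ] H) (K : ℂ → H →L[ℂ] H) : Prop :=
  Γ.eVariation K < ⊤ ∧ Γ.variation K < (Γ.d₀ A) ^ 2 / 4

/-- `r_min(Γ) = d₀(Γ)/2 - √(d₀(Γ)²/4 - 𝒱₀(B, Γ))`. -/
def rMin (Γ : Arc) (A : H →ₗ.[ℂ] H) (K : ℂ → H →L[ℂ] H) : ℝ :=
  Γ.d₀ A / 2 - Real.sqrt ((Γ.d₀ A) ^ 2 / 4 - Γ.variation K)

end Arc

/-! ### Transfer function and basic equation -/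

section Transfer

variable {H : Type*} [NormedAddCommGroup H] [InnerProductSpace ℂ H]

/-- `V₁(Y, Γ) = ∫_Γ K'_B(μ) (Y - μ)⁻¹ dμ` for an operator `Y`. -/
def vOp (K : ℂ → H →L[ℂ] H) (Γ : Arc) (Y : H →ₗ.[ℂ] H) : H →L[ℂ] H :=
  Γ.integral (fun μ => K μ ∘L resolventOp Y μ)

/-- `V₁(z, Γ) = ∫_Γ K'_B(μ) (z - μ)⁻¹ dμ` for a number `z`. -/
def vNum (K : ℂ → H →L[ℂ] H) (Γ : Arc) (z : ℂ) : H →L[ℂ] H :=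
  Γ.integral (fun μ => (z - μ)⁻¹ • K μ)

/-- The continued transfer function `M₁(z, Γ) = A₁ - z + V₁(z, Γ)`. -/
def transfer (A : H →ₗ.[ℂ] H) (K : ℂ → H →L[ℂ] H) (Γ : Arc) (z : ℂ) : H →ₗ.[ℂ] H :=
  addBounded A (vNum K Γ z - z • ContinuousLinearMap.id ℂ H)

/-- The spectrum of the operator function `M₁(·, Γ)` on `ℂ ∖ Γ` (`Γ` with its end points): the `z`
for which `M₁(z, Γ)` has no bounded inverse. -/
def transferSpec (A : H →ₗ.[ℂ] H) (K : ℂ → H →L[ℂ] H) (Γ : Arc) : Set ℂ :=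
  {z | z ∉ closure Γ.range ∧ 0 ∈ spec (transfer A K Γ z)}

/-- `X` is the solution of `X = V₁(A₁ + X, Γ)` in the ball `‖X‖ ≤ r_min(Γ)`. -/
def IsBasicSolution (A : H →ₗ.[ℂ] H) (K : ℂ → H →L[ℂ] H) (Γ : Arc) (X : H →L[ℂ] H) : Prop :=
  X = vOp K Γ (addBounded A X) ∧ ‖X‖ ≤ Γ.rMin A K

/-- Admissible contours `Γ^l`: deformations of `J = (μ₁, μ₂)` inside `D^l`, `K_B`-bounded, with
`ω(B, Γ^l) = d₀(Γ^l)² - 4 𝒱₀(B, Γ^l) > 0`. -/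
def Admissible (A : H →ₗ.[ℂ] H) (K : ℂ → H →L[ℂ] H) (μ₁ μ₂ : EReal) (D : Set ℂ) (l : ℤˣ)
    (Γ : Arc) : Prop :=
  Γ.IsDeformation μ₁ μ₂ (sheet D l) ∧ Γ.SmallVariation A K

/-- `r₀(B)`, the infimum of `r_min(Γ^l)` over the admissible contours `Γ^l`. -/
def r₀ (A : H →ₗ.[ℂ] H) (K : ℂ → H →L[ℂ] H) (μ₁ μ₂ : EReal) (D : Set ℂ) (l : ℤˣ) : ℝ :=
  sInf {r : ℝ | ∃ Γ : Arc, Admissible A K μ₁ μ₂ D l Γ ∧ r = Γ.rMin A K}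

/-- The closed `r`-neighbourhood of the spectrum of `A`. -/
def specNhd (A : H →ₗ.[ℂ] H) (r : ℝ) : Set ℂ := {z | Metric.infDist z (spec A) ≤ r}

end Transfer

end

end OperatorRoot

open OperatorRoot

/-!
The basic equation is solved by the contraction principle, and the operator root is read off from a
factorization of the transfer function. Everything else rests on the fact that the integrals
`V₁(z, Γ)` do not see the contour.

*One contour.* Put `d = d₀(Γ)` and `r = r_min(Γ)`, so that `r (d - r) = 𝒱₀(B, Γ)` and `r < d / 2`.
Since `A₁` is selfadjoint, `‖(A₁ + X - μ)⁻¹‖ ≤ 1 / (d - ‖X‖)` on `Γ` when `‖X‖ < d`. Hence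
`X ↦ V₁(A₁ + X, Γ)` maps the ball of radius `r` into itself and contracts it by the factor
`r / (d - r) < 1` (`existsUnique_isBasicSolution`). For the fixed point `X`, the resolvent identity
gives `M₁(z, Γ) = W(z) (A₁ + X - z)` with
`W(z) = 1 + ∫_Γ K'_B(μ) (z - μ)⁻¹ (A₁ + X - μ)⁻¹ dμ` (`transfer_eq_leftFactor`). If
`dist (z, σ(A₁)) ≤ d / 2`, then `‖W(z) - 1‖ ≤ 2 r / d < 1`, so `W(z)` is invertible, and in this
region the spectrum of the transfer function is that of `A₁ + X` (`transferSpec_inter_specNhd_eq`).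
The bound `‖X‖ ≤ r` also puts the whole spectrum of `A₁ + X` within distance `r` of `σ(A₁)`.

*Independence of the contour.* Let `f` be holomorphic on the simply connected domain `D^l`. It has
a primitive there (`exists_primitive_of_isSimplyConnected`, by lifting along the covering space of
germs of primitives). Near an end of `J`, small circles about the end point (large circles for an
infinite end) are crossed by the deformation of `J` into each of two contours; a crossing lemma for
the unit square yields an arc of such a circle that stays inside `D^l` from the real line to the
contour, and therefore an arc inside `D^l` between the two contours
(`EndDeformation.eventually_exists_crosscut`). If `f` is small on these circles relative to their
radius, the primitive takes nearly equal values on both contours near their common end, and the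
integrals of `f` agree (`Arc.setIntegral_eq_of_endDeformation`). For
`f(μ) = ⟨y, K'_B(μ) x⟩ ((z - μ)⁻¹ - (w - μ)⁻¹)` with `z` and `w` in the half-plane opposite to `D^l`
this applies even at infinite ends, because the difference of the two kernels decays quadratically.
So `V₁(z, Γ) - V₁(z, Γ')` is constant in that half-plane, and it tends to zero at infinity. Analytic
continuation from the opposite half-plane gives `V₁(z, Γ) = V₁(z, Γ')` in the discs about the points
of `σ(A₁)` that meet neither contour (`vNum_eq_of_mem_ball`).

*One root for all contours.* Let `X` and `X'` be the solutions for `Γ` and `Γ'`, with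
`d₀(Γ) ≤ d₀(Γ')`. Where `dist (z, σ(A₁)) < d₀(Γ) / 2` both factorizations describe the same transfer
function, so that `W'(z)⁻¹ W(z) - 1 = (X' - X) (A₁ + X - z)⁻¹`. The left side is holomorphic near
`σ(A₁)`, the right side away from `σ(A₁)`; together they form a bounded entire function that tends
to zero along the imaginary axis. By Liouville's theorem it vanishes, and `X' = X`
(`basicSolution_eq_of_vNum_eq`).
-/


/-! ### Resolvents of unbounded operators -/

namespace OperatorRoot

section Resolvent

variable {H : Type*} [NormedAddCommGroup H] [InnerProductSpace ℂ H]

theorem addBounded_apply (A : H →ₗ.[ℂ] H) (X : H →L[ℂ] H) (u : A.domain) :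
    addBounded A X u = X u + A u := rfl

theorem isResolventAt_resolventOp {T : H →ₗ.[ℂ] H} {z : ℂ} (hz : z ∉ spec T) :
    IsResolventAt T z (resolventOp T z) := by
  have h : ∃ R : H →L[ℂ] H, IsResolventAt T z R := not_not.1 hz
  rw [resolventOp, dif_pos h]
  exact h.choose_spec

/-- The first resolvent identity. -/
theorem IsResolventAt.sub_eq {T : H →ₗ.[ℂ] H} {z w : ℂ} {R S : H →L[ℂ] H}
    (hR : IsResolventAt T z R) (hS : IsResolventAt T w S) : R - S = (z - w) • (R * S) := by
  ext x
  obtain ⟨hx, e⟩ := hS.1 x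
  have h := hR.2 ⟨S x, hx⟩
  have e2 : T ⟨S x, hx⟩ - z • S x = x + (w - z) • S x := by
    rw [sub_eq_iff_eq_add.1 e, sub_smul]; abel
  simp only [e2, map_add, map_smul] at h
  change R x - S x = (z - w) • R (S x)
  nth_rw 1 [← h]
  rw [← neg_sub w z, neg_smul]
  abel

/-- The second resolvent identity, for two bounded perturbations of the same operator. -/
theorem IsResolventAt.sub_eq_of_addBounded {A : H →ₗ.[ℂ] H} {X Y : H →L[ℂ] H} {z : ℂ}
    {R S : H →L[ℂ] H} (hR : IsResolventAt (addBounded A X) z R)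
    (hS : IsResolventAt (addBounded A Y) z S) : S - R = R * (X - Y) * S := by
  ext x
  obtain ⟨hx, e⟩ := hS.1 x
  have h := hR.2 ⟨S x, hx⟩
  have e1 : addBounded A X ⟨S x, hx⟩ - z • S x = x + (X - Y) (S x) := by
    have e' : Y (S x) + A ⟨S x, hx⟩ - z • S x = x := e
    change X (S x) + A ⟨S x, hx⟩ - z • S x = x + (X (S x) - Y (S x))
    nth_rw 4 [← e']
    abel
  change R (addBounded A X ⟨S x, hx⟩ - z • S x) = S x at h
  rw [e1, map_add] at h
  exact sub_eq_of_eq_add' h.symm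

/-- If `T' - z' = W (T - z)` with an invertible bounded `W`, then `T' - z'` inherits the bounded
invertibility of `T - z`. -/
theorem IsResolventAt.of_factor {T T' : H →ₗ.[ℂ] H} {z z' : ℂ} {R W V : H →L[ℂ] H}
    (hR : IsResolventAt T z R) (hdom : T'.domain = T.domain) (hWV : W * V = 1) (hVW : V * W = 1)
    (h : ∀ (u : H) (hu : u ∈ T.domain) (hu' : u ∈ T'.domain),
      T' ⟨u, hu'⟩ - z' • u = W (T ⟨u, hu⟩ - z • u)) :
    IsResolventAt T' z' (R * V) := by
  refine ⟨fun x => ?_, fun u => ?_⟩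
  · obtain ⟨hx, e⟩ := hR.1 (V x)
    refine ⟨hdom ▸ hx, ?_⟩
    have := h (R (V x)) hx (hdom ▸ hx)
    rw [e] at this
    exact this.trans (congrArg (fun S : H →L[ℂ] H => S x) hWV)
  · obtain ⟨u, hu⟩ := u
    have hu' : u ∈ T.domain := hdom ▸ hu
    change R (V (T' ⟨u, hu⟩ - z' • u)) = u
    rw [h u hu' hu]
    have : V (W (T ⟨u, hu'⟩ - z • u)) = T ⟨u, hu'⟩ - z • u :=
      congrArg (fun S : H →L[ℂ] H => S (T ⟨u, hu'⟩ - z • u)) hVW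
    rw [this]
    exact hR.2 ⟨u, hu'⟩

theorem mem_spec_iff_of_factor {T T' : H →ₗ.[ℂ] H} {z z' : ℂ} {W : H →L[ℂ] H}
    (hdom : T'.domain = T.domain) (hW : IsUnit W)
    (h : ∀ (u : H) (hu : u ∈ T.domain) (hu' : u ∈ T'.domain),
      T' ⟨u, hu'⟩ - z' • u = W (T ⟨u, hu⟩ - z • u)) :
    z' ∈ spec T' ↔ z ∈ spec T := by
  obtain ⟨W, rfl⟩ := hW
  refine not_congr ⟨fun ⟨R, hR⟩ => ⟨R * W, ?_⟩, fun ⟨R, hR⟩ => ⟨R * (↑W⁻¹ : H →L[ℂ] H), ?_⟩⟩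
  · refine hR.of_factor hdom.symm W.inv_mul W.mul_inv fun u hu hu' => ?_
    rw [h u hu' hu]
    exact (congrArg (fun S : H →L[ℂ] H => S (T ⟨u, hu'⟩ - z • u)) W.inv_mul).symm
  · exact hR.of_factor hdom W.mul_inv W.inv_mul h

variable [CompleteSpace H]

/-- Resolvents of a symmetric operator at conjugate points are adjoint to each other. -/
theorem IsResolventAt.adjoint_eq {T : H →ₗ.[ℂ] H} (hT : T.IsFormalAdjoint T) {z : ℂ}
    {R S : H →L[ℂ] H} (hR : IsResolventAt T z R)
    (hS : IsResolventAt T ((starRingEnd ℂ) z) S) : ContinuousLinearMap.adjoint R = S := by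
  refine (ContinuousLinearMap.eq_adjoint_iff _ _).2 (fun x y => ?_) |>.symm
  obtain ⟨hx, ex⟩ := hS.1 x
  obtain ⟨hy, ey⟩ := hR.1 y
  have := hT ⟨S x, hx⟩ ⟨R y, hy⟩
  nth_rw 1 [← ey]
  nth_rw 2 [← ex]
  rw [inner_sub_right, inner_sub_left, inner_smul_left, inner_smul_right]
  simp only [RingHomCompTriple.comp_apply, RingHom.id_apply] at *
  rw [this]

/-- The resolvent of a selfadjoint operator with real spectrum is bounded by the inverse distance to
the spectrum: it is a normal bounded operator, so its norm is its spectral radius. -/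
theorem norm_resolventOp_le {A : H →ₗ.[ℂ] H} (hA : IsSelfAdjoint A)
    (hreal : ∀ w ∈ spec A, w.im = 0) {z : ℂ} {d : ℝ} (hd : 0 < d)
    (hz : ∀ w ∈ spec A, d ≤ dist z w) :
    z ∉ spec A ∧ ‖resolventOp A z‖ ≤ 1 / d := by
  have hmem : ∀ w, dist z w < d → w ∉ spec A := fun w hw h => (hz w h).not_gt hw
  have hz0 : z ∉ spec A := hmem z (by simpa using hd)
  refine ⟨hz0, ?_⟩
  have hconj : (starRingEnd ℂ) z ∉ spec A := by
    intro h
    have h0 : z.im = 0 := by simpa using hreal _ h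
    rw [Complex.conj_eq_iff_im.2 h0] at h
    exact hz0 h
  have hR := isResolventAt_resolventOp hz0
  have hS := isResolventAt_resolventOp hconj
  set R := resolventOp A z
  set S := resolventOp A ((starRingEnd ℂ) z)
  -- `R` is normal: its adjoint is the resolvent at the conjugate point, which commutes with it
  have hsym : A.IsFormalAdjoint A := by
    have := LinearPMap.adjoint_isFormalAdjoint (T := A) hA.dense_domain
    rwa [LinearPMap.isSelfAdjoint_def.1 hA] at this
  have hadj : star R = S := hR.adjoint_eq hsym hS
  have hcomm : Commute S R := by
    by_cases hzz : z = (starRingEnd ℂ) z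
    · rw [show S = R by simp only [S, R, ← hzz]]
    · have h1 := hR.sub_eq hS
      have h2 := hS.sub_eq hR
      have h3 : (z - (starRingEnd ℂ) z) • (S * R - R * S) = 0 := by
        rw [smul_sub, ← h1, ← neg_sub ((starRingEnd ℂ) z) z, neg_smul, ← h2]
        abel
      exact sub_eq_zero.1 ((smul_eq_zero.1 h3).resolve_left (sub_ne_zero.2 hzz))
  have hnormal : IsStarNormal R := ⟨by rw [hadj]; exact hcomm⟩
  -- if `‖ζ‖ > 1 / d`, then `z + ζ⁻¹` is not in the spectrum of `A`
  have hspec : ∀ ζ ∈ spectrum ℂ R, ‖ζ‖ ≤ 1 / d := by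
    intro ζ hζ
    by_contra! hlt
    refine hζ ?_
    have hζ0 : ζ ≠ 0 := by
      rintro rfl
      rw [norm_zero] at hlt
      exact hlt.not_gt (by positivity)
    have hw : z + ζ⁻¹ ∉ spec A := by
      refine hmem _ ?_
      rw [dist_self_add_right, norm_inv]
      exact inv_lt_of_inv_lt₀ hd (by simpa using hlt)
    have hT := isResolventAt_resolventOp hw
    set T := resolventOp A (z + ζ⁻¹)
    have h1 := hT.sub_eq hR
    have h2 := hR.sub_eq hT
    rw [add_sub_cancel_left] at h1
    rw [sub_add_cancel_left] at h2
    have h1' : T * R = ζ • (T - R) := by rw [h1, smul_smul, mul_inv_cancel₀ hζ0, one_smul]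
    have h2' : R * T = ζ • (T - R) := by
      rw [← neg_sub R T, h2, neg_smul, neg_neg, smul_smul, mul_inv_cancel₀ hζ0, one_smul]
    -- the inverse of `ζ - R` is `ζ⁻¹ + ζ⁻² (A - z - ζ⁻¹)⁻¹`
    refine ⟨⟨algebraMap ℂ _ ζ - R, ζ⁻¹ • (1 + ζ⁻¹ • T), ?_, ?_⟩, rfl⟩
    · simp only [Algebra.algebraMap_eq_smul_one, mul_smul_comm, smul_mul_assoc, mul_add, sub_mul,
        one_mul, mul_one, h2', smul_smul, mul_assoc, inv_mul_cancel₀ hζ0, one_smul,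
        smul_sub, smul_add]
      abel
    · simp only [Algebra.algebraMap_eq_smul_one, mul_smul_comm, smul_mul_assoc, add_mul, mul_sub,
        one_mul, mul_one, h1', smul_smul, mul_assoc, mul_left_comm ζ, inv_mul_cancel₀ hζ0,
        mul_inv_cancel₀ hζ0, one_smul, smul_sub, smul_add]
      abel
  have hrad : spectralRadius ℂ R ≤ ENNReal.ofReal (1 / d) := by
    refine iSup₂_le fun ζ hζ => ?_
    rw [← enorm_eq_nnnorm, ← ofReal_norm]
    exact ENNReal.ofReal_le_ofReal (hspec ζ hζ)
  rw [IsStarNormal.spectralRadius_eq_nnnorm, ← enorm_eq_nnnorm, ← ofReal_norm] at hrad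
  exact (ENNReal.ofReal_le_ofReal_iff (by positivity)).1 hrad

/-- Neumann series: a bounded perturbation `X` of a selfadjoint operator moves the spectrum by at
most `‖X‖`. -/
theorem norm_resolventOp_addBounded_le {A : H →ₗ.[ℂ] H} (hA : IsSelfAdjoint A)
    (hreal : ∀ w ∈ spec A, w.im = 0) {X : H →L[ℂ] H} {z : ℂ} {d : ℝ} (hd : ‖X‖ < d)
    (hz : ∀ w ∈ spec A, d ≤ dist z w) :
    z ∉ spec (addBounded A X) ∧ ‖resolventOp (addBounded A X) z‖ ≤ 1 / (d - ‖X‖) := by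
  have hd0 : 0 < d := (norm_nonneg X).trans_lt hd
  obtain ⟨hz0, hle⟩ := norm_resolventOp_le hA hreal hd0 hz
  have hR := isResolventAt_resolventOp hz0
  set R := resolventOp A z
  have hXR : ‖-(X * R)‖ < 1 := by
    rw [norm_neg]
    calc ‖X * R‖ ≤ ‖X‖ * (1 / d) := (norm_mul_le _ _).trans (by gcongr)
      _ < 1 := by rw [mul_one_div, div_lt_one hd0]; exact hd
  have hunit : IsUnit (1 + X * R) := by
    have := (Units.oneSub _ hXR).isUnit
    rwa [Units.val_oneSub, sub_neg_eq_add] at this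
  have hmem : z ∉ spec (addBounded A X) := by
    refine fun h => hz0 ((mem_spec_iff_of_factor (T := A) (T' := addBounded A X) (z := z) rfl hunit
      fun u hu hu' => ?_).1 h)
    have := hR.2 ⟨u, hu⟩
    change X u + A ⟨u, hu⟩ - z • u = (A ⟨u, hu⟩ - z • u) + X (R (A ⟨u, hu⟩ - z • u))
    change R (A ⟨u, hu⟩ - z • u) = u at this
    rw [this]
    abel
  refine ⟨hmem, ?_⟩
  have hS := isResolventAt_resolventOp hmem
  have hR' : IsResolventAt (addBounded A 0) z R := by
    rwa [show addBounded A (0 : H →L[ℂ] H) = A from zero_vadd (H →ₗ[ℂ] H) A]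
  set S := resolventOp (addBounded A X) z
  have h1 : S = R + R * (0 - X) * S := by rw [← hR'.sub_eq_of_addBounded hS]; abel
  have h2 : ‖S‖ ≤ 1 / d + 1 / d * ‖X‖ * ‖S‖ := by
    calc ‖S‖ = ‖R + R * (0 - X) * S‖ := by rw [← h1]
      _ ≤ ‖R‖ + ‖R‖ * ‖X‖ * ‖S‖ := by
        refine (norm_add_le _ _).trans ?_
        gcongr
        refine (norm_mul_le _ _).trans ?_
        gcongr
        refine (norm_mul_le _ _).trans_eq ?_
        rw [zero_sub, norm_neg]
      _ ≤ _ := by gcongr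
  rw [le_div_iff₀ (sub_pos.2 hd)]
  have h3 : d * (1 / d + 1 / d * ‖X‖ * ‖S‖) = 1 + ‖X‖ * ‖S‖ := by field_simp
  have h4 := mul_le_mul_of_nonneg_left h2 hd0.le
  rw [h3] at h4
  linarith

/-- The resolvent is Lipschitz on sets where it is bounded. -/
theorem dist_resolventOp_le {T : H →ₗ.[ℂ] H} {z w : ℂ} {C : ℝ} (hz : z ∉ spec T) (hw : w ∉ spec T)
    (hzC : ‖resolventOp T z‖ ≤ C) (hwC : ‖resolventOp T w‖ ≤ C) :
    dist (resolventOp T z) (resolventOp T w) ≤ C * C * dist z w := by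
  rw [dist_eq_norm, (isResolventAt_resolventOp hz).sub_eq (isResolventAt_resolventOp hw), norm_smul,
    ← dist_eq_norm, mul_comm]
  have := (norm_nonneg _).trans hzC
  gcongr
  refine (norm_mul_le _ _).trans ?_
  gcongr

theorem continuousOn_resolventOp {T : H →ₗ.[ℂ] H} {s : Set ℂ} {C : ℝ} (hs : ∀ z ∈ s, z ∉ spec T)
    (hC : ∀ z ∈ s, ‖resolventOp T z‖ ≤ C) : ContinuousOn (resolventOp T) s := by
  have : LipschitzOnWith (C * C).toNNReal (resolventOp T) s :=
    LipschitzOnWith.of_dist_le_mul fun z hz w hw => by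
      rw [Real.coe_toNNReal _ (mul_self_nonneg C)]
      exact dist_resolventOp_le (hs z hz) (hs w hw) (hC z hz) (hC w hw)
  exact this.continuousOn

theorem differentiableOn_resolventOp {T : H →ₗ.[ℂ] H} {s : Set ℂ} {C : ℝ} (ho : IsOpen s)
    (hs : ∀ z ∈ s, z ∉ spec T) (hC : ∀ z ∈ s, ‖resolventOp T z‖ ≤ C) :
    DifferentiableOn ℂ (resolventOp T) s := by
  intro z hz
  have hcont := (continuousOn_resolventOp hs hC).continuousAt (ho.mem_nhds hz)
  refine (HasDerivAt.differentiableAt (f' := resolventOp T z * resolventOp T z)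
    ?_).differentiableWithinAt
  rw [hasDerivAt_iff_tendsto_slope]
  have h1 : Tendsto (fun w => resolventOp T w * resolventOp T z) (𝓝[≠] z)
      (𝓝 (resolventOp T z * resolventOp T z)) :=
    (hcont.tendsto.mono_left nhdsWithin_le_nhds).mul tendsto_const_nhds
  refine h1.congr' ?_
  filter_upwards [self_mem_nhdsWithin, mem_nhdsWithin_of_mem_nhds (ho.mem_nhds hz)] with w hw hws
  rw [slope_def_module, (isResolventAt_resolventOp (hs w hws)).sub_eq
    (isResolventAt_resolventOp (hs z hz)), smul_smul, inv_mul_cancel₀ (sub_ne_zero.2 hw), one_smul]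

end Resolvent

/-! ### Primitives on simply connected domains -/

section Potential

variable {X A : Type*} [TopologicalSpace X] [AddCommGroup A]

/-- The space of germs of potentials: a point `(x, a)` stands for the germ at `x` of the function
`w ↦ a + F x w - F x x`, where `F x` is a given local potential at `x`. -/
def PotentialSpace (_F : X → X → A) : Type _ := X × A

/-- A set of germs is open if with every germ it contains its continuations to nearby points. -/
instance (F : X → X → A) : TopologicalSpace (PotentialSpace F) where
  IsOpen s := ∀ e ∈ s, ∀ᶠ w in 𝓝 e.1, ((w, e.2 + (F e.1 w - F e.1 e.1)) : X × A) ∈ s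
  isOpen_univ := fun _ _ => Eventually.of_forall fun _ => mem_univ _
  isOpen_inter := fun _ _ hs ht e he => (hs e he.1).and (ht e he.2)
  isOpen_sUnion := fun _ hS e ⟨s, hs, he⟩ =>
    (hS s hs e he).mono fun _ hw => mem_sUnion_of_mem hw hs

theorem PotentialSpace.isOpen_iff {F : X → X → A} {s : Set (PotentialSpace F)} :
    IsOpen s ↔ ∀ e ∈ s, ∀ᶠ w in 𝓝 e.1, ((w, e.2 + (F e.1 w - F e.1 e.1)) : X × A) ∈ s :=
  Iff.rfl

/-- Germs that near `x` agree up to prescribed constants with the potential `F x` form an open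
set. -/
theorem PotentialSpace.isOpen_sheet {F : X → X → A} {x : X} {V : Set X} (hV : IsOpen V)
    (h : ∀ y ∈ V, ∀ᶠ w in 𝓝 y, F y w - F y y = F x w - F x y) (s : Set A) :
    IsOpen {e : PotentialSpace F | e.1 ∈ V ∧ e.2 - F x e.1 ∈ s} := by
  refine isOpen_iff.2 fun e he => ?_
  filter_upwards [h e.1 he.1, hV.mem_nhds he.1] with w hw hwV
  refine ⟨hwV, ?_⟩
  have : e.2 + (F e.1 w - F e.1 e.1) - F x w = e.2 - F x e.1 := by rw [hw]; abel
  change e.2 + (F e.1 w - F e.1 e.1) - F x w ∈ s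
  rw [this]
  exact he.2

/-- If the local potentials differ by local constants, the space of germs is a covering space: over
`V` it is the product of `V` with the discrete space of constants, by `e ↦ e.2 - F x e.1`. -/
theorem PotentialSpace.isCoveringMap {F : X → X → A}
    (hF : ∀ x, ∃ V, IsOpen V ∧ x ∈ V ∧ ∀ y ∈ V, ∀ᶠ w in 𝓝 y, F y w - F y y = F x w - F x y) :
    IsCoveringMap (fun e : PotentialSpace F => e.1) := by
  -- the fibre is discrete, whatever topology the values carry elsewhere
  let _ : TopologicalSpace A := ⊥
  have : DiscreteTopology A := ⟨rfl⟩
  have hcont : Continuous (fun e : PotentialSpace F => e.1) :=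
    ⟨fun s hs => isOpen_iff.2 fun e he => hs.mem_nhds he⟩
  intro x
  obtain ⟨V, hV, hx, h⟩ := hF x
  refine IsEvenlyCovered.to_isEvenlyCovered_preimage (I := A) ⟨inferInstance, V, hx, hV,
    hV.preimage hcont, ⟨⟨fun e => (⟨e.1.1, e.2⟩, e.1.2 - F x e.1.1),
      fun p => ⟨((p.1.1, p.2 + F x p.1.1) : X × A), p.1.2⟩, fun e => ?_, fun p => ?_⟩, ?_, ?_⟩,
      fun _ => rfl⟩
  · exact Subtype.ext (Prod.ext rfl (sub_add_cancel _ _))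
  · exact Prod.ext rfl (add_sub_cancel_right _ _)
  · refine Continuous.prodMk (Continuous.subtype_mk (hcont.comp continuous_subtype_val) _) ?_
    refine ⟨fun s _ => ?_⟩
    refine isOpen_induced_iff.2 ⟨_, isOpen_sheet hV h s, ?_⟩
    ext e
    exact ⟨fun h => h.2, fun h => ⟨e.2, h⟩⟩
  · refine Continuous.subtype_mk ⟨fun s hs => ?_⟩ _
    rw [_root_.isOpen_iff_mem_nhds]
    rintro ⟨y, b⟩ hyb
    have h1 := isOpen_iff.1 hs _ hyb
    have h2 := h1.and (h y.1 y.2)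
    have h3 : ∀ᶠ w in 𝓝 (y : X), ((w, b + F x w) : X × A) ∈ s := by
      refine h2.mono fun w hw => ?_
      have := hw.1
      change ((w, b + F x y.1 + (F y.1 w - F y.1 y.1)) : X × A) ∈ s at this
      rw [hw.2] at this
      convert this using 2
      abel
    change {p : V × A | ((p.1.1, p.2 + F x p.1.1) : X × A) ∈ s} ∈ 𝓝 (y, b)
    rw [nhds_prod_eq, nhds_discrete A]
    exact mem_of_superset (prod_mem_prod
      ((continuous_subtype_val.continuousAt (x := y)).eventually h3)
      (mem_pure.2 rfl : ({b} : Set A) ∈ pure b))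
      fun p ⟨hp, (hb : p.2 = b)⟩ => by
        change ((p.1.1, p.2 + F x p.1.1) : X × A) ∈ s
        rw [hb]; exact hp

/-- On a simply connected space, local potentials that differ by local constants come from a global
potential. -/
theorem exists_global_potential [SimplyConnectedSpace X] [LocallyPathConnectedSpace X]
    {F : X → X → A}
    (hF : ∀ x, ∃ V, IsOpen V ∧ x ∈ V ∧ ∀ y ∈ V, ∀ᶠ w in 𝓝 y, F y w - F y y = F x w - F x y) :
    ∃ G : X → A, ∀ x, ∀ᶠ w in 𝓝 x, G w - G x = F x w - F x x := by
  obtain ⟨x₀⟩ : Nonempty X := inferInstance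
  obtain ⟨G, ⟨-, hG⟩, -⟩ := (PotentialSpace.isCoveringMap hF).existsUnique_continuousMap_lifts
    (ContinuousMap.id X) x₀ ((x₀, 0) : X × A) rfl
  have hG' : ∀ x, (G x).1 = x := fun x => congrFun hG x
  refine ⟨fun x => (G x).2, fun x => ?_⟩
  obtain ⟨V, hV, hx, h⟩ := hF x
  have ho := PotentialSpace.isOpen_sheet hV h {(G x).2 - F x x}
  filter_upwards [(ho.preimage G.continuous).mem_nhds (x := x)
    ⟨by rw [hG']; exact hx, by rw [hG']; rfl⟩] with w hw
  have h2 := hw.2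
  rw [hG' w, mem_singleton_iff] at h2
  rw [sub_eq_sub_iff_add_eq_add] at h2 ⊢
  rw [h2]; abel

end Potential

/-- A holomorphic function on a simply connected domain has a primitive. -/
theorem exists_primitive_of_isSimplyConnected {U : Set ℂ} (hU : IsOpen U)
    (hUs : IsSimplyConnected U) {f : ℂ → ℂ} (hf : DifferentiableOn ℂ f U) :
    ∃ G : ℂ → ℂ, ∀ z ∈ U, HasDerivAt G (f z) z := by
  classical
  have := hUs.simplyConnectedSpace
  have := hU.locallyPathConnectedSpace
  have hloc : ∀ x : U, ∃ F : ℂ → ℂ, ∃ ε > 0, Metric.ball (x : ℂ) ε ⊆ U ∧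
      ∀ z ∈ Metric.ball (x : ℂ) ε, HasDerivAt F (f z) z := by
    intro x
    obtain ⟨ε, hε, hεU⟩ := Metric.isOpen_iff.1 hU x x.2
    obtain ⟨F, hF⟩ := (hf.mono hεU).isExactOn_ball
    exact ⟨F, ε, hε, hεU, hF⟩
  choose F ε hε hεU hF using hloc
  -- two primitives differ by a constant on a ball
  have hconst : ∀ x y : U, (y : ℂ) ∈ Metric.ball (x : ℂ) (ε x) →
      ∀ᶠ w in 𝓝 (y : ℂ), F y w - F y y = F x w - F x y := by
    intro x y hy
    obtain ⟨δ, hδ, hδs⟩ := Metric.isOpen_iff.1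
      ((Metric.isOpen_ball (x := (x : ℂ)) (ε := ε x)).inter
        (Metric.isOpen_ball (x := (y : ℂ)) (ε := ε y))) y ⟨hy, Metric.mem_ball_self (hε y)⟩
    filter_upwards [Metric.ball_mem_nhds (y : ℂ) hδ] with w hw
    have hd : ∀ z ∈ Metric.ball (y : ℂ) δ, HasDerivAt (fun z => F y z - F x z) 0 z := fun z hz => by
      have := (hF y z (hδs hz).2).sub (hF x z (hδs hz).1)
      rwa [sub_self] at this
    have := (convex_ball (y : ℂ) δ).is_const_of_fderivWithin_eq_zero (𝕜 := ℂ)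
      (fun z hz => (hd z hz).differentiableAt.differentiableWithinAt)
      (fun z hz => by
        rw [fderivWithin_of_isOpen Metric.isOpen_ball hz]
        exact (hasDerivAt_iff_hasFDerivAt.1 (hd z hz)).fderiv.trans (by ext; simp))
      hw (Metric.mem_ball_self hδ)
    linear_combination this
  obtain ⟨G, hG⟩ := exists_global_potential (X := U) (A := ℂ) (F := fun x w => F x w) fun x =>
    ⟨Subtype.val ⁻¹' Metric.ball (x : ℂ) (ε x), Metric.isOpen_ball.preimage continuous_subtype_val,
      Metric.mem_ball_self (hε x), fun y hy =>
        continuous_subtype_val.continuousAt.eventually (hconst x y hy)⟩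
  refine ⟨fun z => if hz : z ∈ U then G ⟨z, hz⟩ else 0, fun z hz => ?_⟩
  have h1 : ∀ᶠ w in 𝓝 z, (if hw : w ∈ U then G ⟨w, hw⟩ else 0) =
      F ⟨z, hz⟩ w + (G ⟨z, hz⟩ - F ⟨z, hz⟩ z) := by
    have h2 := hG ⟨z, hz⟩
    rw [nhds_subtype_eq_comap, eventually_comap] at h2
    filter_upwards [h2, hU.mem_nhds hz] with w hw hwU
    rw [dif_pos hwU]
    have := hw ⟨w, hwU⟩ rfl
    linear_combination this
  exact ((hF ⟨z, hz⟩ z (Metric.mem_ball_self (hε _))).add_const _).congr_of_eventuallyEq h1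

/-! ### A crossing lemma for the unit square -/

section Crossing

open unitInterval

/-- If no connected component of a compact Hausdorff space meets both closed sets `a` and `b`, then
a clopen set separates them. -/
theorem exists_isClopen_separating {X : Type*} [TopologicalSpace X] [CompactSpace X] [T2Space X]
    {a b : Set X} (ha : IsClosed a) (hb : IsClosed b)
    (h : ∀ x ∈ a, ∀ y ∈ b, y ∉ connectedComponent x) :
    ∃ Z : Set X, IsClopen Z ∧ a ⊆ Z ∧ Disjoint Z b := by
  refine ha.isCompact.induction_on (p := fun s => ∃ Z : Set X, IsClopen Z ∧ s ⊆ Z ∧ Disjoint Z b)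
    ⟨∅, isClopen_empty, Subset.rfl, disjoint_bot_left⟩
    (fun s t hst ⟨Z, hZ, hs, hd⟩ => ⟨Z, hZ, hst.trans hs, hd⟩)
    (fun s t ⟨Z, hZ, hs, hd⟩ ⟨Z', hZ', hs', hd'⟩ =>
      ⟨Z ∪ Z', hZ.union hZ', union_subset_union hs hs', hd.union_left hd'⟩) fun x hx => ?_
  have hempty : b ∩ ⋂ s : { s : Set X // IsClopen s ∧ x ∈ s }, (s : Set X) = ∅ := by
    rw [← connectedComponent_eq_iInter_isClopen]
    exact eq_empty_of_forall_notMem fun y hy => h x hx y hy.1 hy.2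
  obtain ⟨u, hu⟩ := hb.isCompact.elim_finite_subfamily_closed _ (fun s => s.2.1.isClosed) hempty
  have hclopen : IsClopen (⋂ s ∈ u, (s : Set X)) := isClopen_biInter_finset fun s _ => s.2.1
  refine ⟨_, mem_nhdsWithin_of_mem_nhds (hclopen.isOpen.mem_nhds ?_), _, hclopen, Subset.rfl, ?_⟩
  · exact mem_iInter₂.2 fun s _ => s.2.2
  · rw [disjoint_iff_inter_eq_empty, inter_comm]
    exact hu

/-- A continuous function on the unit interval with values in `2πiℤ` is constant. -/
theorem eq_of_exp_eq_one {g : I → ℂ} (hg : Continuous g) (h : ∀ t, Complex.exp (g t) = 1)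
    (s t : I) : g s = g t := by
  refine IsLocallyConstant.apply_eq_of_preconnectedSpace
    ((IsLocallyConstant.iff_eventually_eq g).2 fun x => ?_) s t
  filter_upwards [Metric.continuous_iff'.1 hg x 1 one_pos] with y hy
  have h1 : Complex.exp (g y - g x) = 1 := by rw [Complex.exp_sub, h, h, div_one]
  obtain ⟨n, hn⟩ := Complex.exp_eq_one_iff.1 h1
  rw [dist_eq_norm, hn] at hy
  have h2 : ‖(n : ℂ) * (2 * Real.pi * Complex.I)‖ = |(n : ℝ)| * (2 * Real.pi) := by
    simp [abs_of_pos Real.pi_pos]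
  rw [h2] at hy
  have h3 : |(n : ℝ)| < 1 := by nlinarith [Real.pi_gt_three, abs_nonneg (n : ℝ)]
  have h4 : n = 0 := by
    have : |n| < 1 := by exact_mod_cast h3
    exact Int.abs_lt_one_iff.1 this
  rw [h4, Int.cast_zero, zero_mul] at hn
  exact sub_eq_zero.1 hn

/-- A nowhere vanishing continuous function on the unit square has a continuous logarithm. -/
theorem exists_log_on_square {φ : I × I → ℂ} (hφ : Continuous φ) (h0 : ∀ p, φ p ≠ 0) :
    ∃ f : I × I → ℂ, Continuous f ∧ ∀ p, Complex.exp (f p) = φ p := by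
  have hsc : IsSimplyConnected (univ : Set (ℝ × ℝ)) := by
    have : SimplyConnectedSpace (ℝ × ℝ) := SimplyConnectedSpace.ofContractible _
    exact (Homeomorph.Set.univ (ℝ × ℝ)).toHomotopyEquiv.simplyConnectedSpace_iff.2 this
  -- the square is a retract of the plane, where the logarithm exists by simple connectedness
  let pr : ℝ × ℝ → I × I := Prod.map (projIcc 0 1 zero_le_one) (projIcc 0 1 zero_le_one)
  have hpr : Continuous pr := continuous_projIcc.prodMap continuous_projIcc
  obtain ⟨f, hf, hfe⟩ := Complex.exists_continuousOn_eqOn_exp_comp hsc isOpen_univ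
    (g := φ ∘ pr) (hφ.comp hpr).continuousOn (by rintro ⟨p, -, hp⟩; exact h0 _ hp)
  refine ⟨fun p => f (p.1, p.2), (continuousOn_univ.1 hf).comp (by fun_prop), fun p => ?_⟩
  have := hfe (mem_univ ((p.1 : ℝ), (p.2 : ℝ)))
  simpa [pr] using this

/-- If a continuous function on the unit square is negative on the bottom side and positive on the
top side, then a connected part of its zero set joins the left side to the right side. Otherwise the
zero set splits into a part `v = 0` containing its points on the left and a part `v = 1` containing
its points on the right, and a logarithm of the function equal to `exp (iπv)` where `u ≤ 0` and to
`exp (-iπv)` where `u ≥ 0` would change by `2πi` around the boundary. -/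
theorem exists_isPreconnected_crossing {u : I × I → ℝ} (hu : Continuous u)
    (h0 : ∀ s, u (s, 0) < 0) (h1 : ∀ s, 0 < u (s, 1)) :
    ∃ C : Set (I × I), IsPreconnected C ∧ (∀ p ∈ C, u p = 0) ∧ (∃ t, (0, t) ∈ C) ∧
      ∃ t, (1, t) ∈ C := by
  set L : Set (I × I) := {p | u p = 0} with hL
  have hLc : IsClosed L := isClosed_eq hu continuous_const
  have : CompactSpace L := isCompact_iff_compactSpace.1 hLc.isCompact
  by_contra! hno
  obtain ⟨Z, hZ, hZl, hZr⟩ := exists_isClopen_separating (X := L)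
    (a := {p | p.1.1 = 0}) (b := {p | p.1.1 = 1})
    (isClosed_eq (by fun_prop) continuous_const) (isClosed_eq (by fun_prop) continuous_const)
    (fun x hx y hy hyx => by
      refine hno (Subtype.val '' connectedComponent x)
        (isPreconnected_connectedComponent.image _ continuous_subtype_val.continuousOn)
        (by rintro _ ⟨p, -, rfl⟩; exact p.2) ⟨x.1.2, x, mem_connectedComponent, ?_⟩
        y.1.2 ⟨y, hyx, ?_⟩
      · exact Prod.ext hx rfl
      · exact Prod.ext hy rfl)
  obtain ⟨v, hv0, hv1, -⟩ := exists_continuous_zero_one_of_isClosed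
    (hLc.isClosedMap_subtype_val _ hZ.isClosed) (hLc.isClosedMap_subtype_val _ hZ.compl.isClosed)
    (disjoint_image_of_injective Subtype.val_injective disjoint_compl_right)
  have hvl : ∀ t, u (0, t) = 0 → v (0, t) = 0 := fun t ht =>
    hv0 ⟨⟨(0, t), ht⟩, hZl rfl, rfl⟩
  have hvr : ∀ t, u (1, t) = 0 → v (1, t) = 1 := fun t ht =>
    hv1 ⟨⟨(1, t), ht⟩, fun h => hZr.le_bot ⟨h, rfl⟩, rfl⟩
  have hv : ∀ p, u p = 0 → v p = 0 ∨ v p = 1 := fun p hp => by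
    by_cases h : (⟨p, hp⟩ : L) ∈ Z
    · exact Or.inl (hv0 ⟨_, h, rfl⟩)
    · exact Or.inr (hv1 ⟨_, h, rfl⟩)
  have hvc : Continuous v := v.continuous
  obtain ⟨f, hf, hfe⟩ := exists_log_on_square
    (φ := fun p => if u p ≤ 0 then Complex.exp (Real.pi * Complex.I * v p)
      else Complex.exp (-(Real.pi * Complex.I * v p)))
    (Continuous.if_le (by fun_prop) (by fun_prop) hu continuous_const fun p hp => by
      rcases hv p hp with h | h
      · simp [h]
      · simp [h, Complex.exp_neg, Complex.exp_pi_mul_I])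
    (fun p => by split_ifs <;> exact Complex.exp_ne_zero _)
  have hle : ∀ p, u p ≤ 0 → Complex.exp (f p) = Complex.exp (Real.pi * Complex.I * v p) :=
    fun p hp => by rw [hfe, if_pos hp]
  have hgt : ∀ p, 0 < u p → Complex.exp (f p) = Complex.exp (-(Real.pi * Complex.I * v p)) :=
    fun p hp => by rw [hfe, if_neg hp.not_ge]
  -- compare the logarithm `f` with `±iπv` (up to `2πi`) along each of the four sides
  have hbot := eq_of_exp_eq_one (g := fun s => f (s, 0) - Real.pi * Complex.I * v (s, 0))
    (by fun_prop) (fun s => by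
      rw [Complex.exp_sub, hle _ (h0 s).le, div_self (Complex.exp_ne_zero _)]) 0 1
  have htop := eq_of_exp_eq_one (g := fun s => f (s, 1) + Real.pi * Complex.I * v (s, 1))
    (by fun_prop) (fun s => by
      rw [Complex.exp_add, hgt _ (h1 s), ← Complex.exp_add, neg_add_cancel, Complex.exp_zero]) 0 1
  have hleft := eq_of_exp_eq_one (g := fun t => f (0, t) - if u (0, t) ≤ 0 then
      Real.pi * Complex.I * v (0, t) else -(Real.pi * Complex.I * v (0, t)))
    (by
      refine (by fun_prop : Continuous fun t => f (0, t)).sub (Continuous.if_le (by fun_prop)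
        (by fun_prop) (by fun_prop) continuous_const fun t ht => ?_)
      simp [hvl t ht])
    (fun t => by
      split_ifs with h
      · rw [Complex.exp_sub, hle _ h, div_self (Complex.exp_ne_zero _)]
      · rw [Complex.exp_sub, hgt _ (not_le.1 h), div_self (Complex.exp_ne_zero _)]) 0 1
  have hright := eq_of_exp_eq_one (g := fun t => f (1, t) - if u (1, t) ≤ 0 then
      Real.pi * Complex.I * v (1, t)
      else 2 * Real.pi * Complex.I - Real.pi * Complex.I * v (1, t))
    (by
      refine (by fun_prop : Continuous fun t => f (1, t)).sub (Continuous.if_le (by fun_prop)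
        (by fun_prop) (by fun_prop) continuous_const fun t ht => ?_)
      rw [hvr t ht]; push_cast; ring)
    (fun t => by
      split_ifs with h
      · rw [Complex.exp_sub, hle _ h, div_self (Complex.exp_ne_zero _)]
      · rw [Complex.exp_sub, hgt _ (not_le.1 h), Complex.exp_sub, Complex.exp_two_pi_mul_I,
          one_div, ← Complex.exp_neg, div_self (Complex.exp_ne_zero _)]) 0 1
  simp only [(h0 _).le, (h1 _).not_ge, if_true, if_false] at hleft hright
  have : (2 * Real.pi * Complex.I : ℂ) = 0 := by
    linear_combination hright - htop - hleft + hbot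
  exact Complex.two_pi_I_ne_zero this

end Crossing

/-! ### Circular crosscuts between homotopic arcs -/

/-- If a homotopy in `D` from a piece of the real line crosses the circle of radius `ρ` about `c`,
then `D` contains an arc of that circle joining the real line to the final curve. -/
theorem exists_crosscut {D : Set ℂ} {h : ℝ → ℝ → ℂ} {σ ε c ρ t₀ t₁ : ℝ} (hε : ε = 1 ∨ ε = -1)
    (hcont : ContinuousOn (Function.uncurry h) (Icc 0 1 ×ˢ uIcc t₀ t₁))
    (hreal : ∀ t ∈ uIcc t₀ t₁, (h 0 t).im = 0 ∧ 0 < ε * ((h 0 t).re - c))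
    (hmem : ∀ t ∈ uIcc t₀ t₁, ∀ s ∈ Ioc (0 : ℝ) 1, h s t ∈ D)
    (hD : ∀ w ∈ D, 0 < σ * w.im)
    (h0 : ∀ s ∈ Icc (0 : ℝ) 1, ‖h s t₀ - c‖ < ρ) (h1 : ∀ s ∈ Icc (0 : ℝ) 1, ρ < ‖h s t₁ - c‖) :
    ∃ t ∈ uIcc t₀ t₁, ‖h 1 t - c‖ = ρ ∧ ∀ w : ℂ, ‖w - c‖ = ρ → 0 < σ * w.im →
      w.re ∈ uIcc (h 1 t).re (c + ε * ρ) → w ∈ D := by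
  let T : ℝ → ℝ := fun τ => t₀ + τ * (t₁ - t₀)
  have hT : ∀ τ : unitInterval, T τ ∈ uIcc t₀ t₁ := fun τ => by
    have := (convex_uIcc (𝕜 := ℝ) t₀ t₁).add_smul_sub_mem left_mem_uIcc right_mem_uIcc τ.2
    simpa [T] using this
  have hhc : Continuous fun p : unitInterval × unitInterval => h p.1 (T p.2) :=
    hcont.comp_continuous (f := fun p : unitInterval × unitInterval => ((p.1 : ℝ), T p.2))
      (by fun_prop) (fun p => ⟨p.1.2, hT p.2⟩)
  obtain ⟨C, hC, hCu, ⟨τ₀, hτ₀⟩, τ₁, hτ₁⟩ := exists_isPreconnected_crossing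
    (u := fun p : unitInterval × unitInterval => ‖h p.1 (T p.2) - c‖ - ρ)
    ((hhc.sub continuous_const).norm.sub continuous_const)
    (fun s => by simpa [T] using h0 s s.2) (fun s => by simpa [T] using h1 s s.2)
  have hρ : ∀ p ∈ C, ‖h p.1 (T p.2) - c‖ = ρ := fun p hp => sub_eq_zero.1 (hCu p hp)
  have hsq : ∀ w : ℂ, ‖w - c‖ = ρ → (w.re - c) ^ 2 + w.im ^ 2 = ρ ^ 2 := fun w hw => by
    rw [← hw, ← Complex.normSq_eq_norm_sq, Complex.normSq_apply]
    simp [sq]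
  have hρ0 : 0 ≤ ρ := (norm_nonneg _).trans_eq (hρ _ hτ₀)
  refine ⟨T τ₁, hT τ₁, by simpa using hρ _ hτ₁, fun w hw hwi hwre => ?_⟩
  have he : (h 0 (T τ₀)).re = c + ε * ρ := by
    obtain ⟨hi, hpos⟩ := hreal _ (hT τ₀)
    have := hsq _ (hρ _ hτ₀)
    simp only [Icc.coe_zero, hi] at this
    have h2 : ((h 0 (T τ₀)).re - c) = ρ ∨ ((h 0 (T τ₀)).re - c) = -ρ :=
      sq_eq_sq_iff_eq_or_eq_neg.1 (by linarith)
    rcases hε with rfl | rfl <;> rcases h2 with h2 | h2 <;> rw [h2] at hpos <;> linarith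
  -- the points of `C` lie on the circle, and by connectedness their real parts cover the interval
  -- between the real parts of its extreme points
  obtain ⟨p, hp, hpre⟩ :
      w.re ∈ (fun p : unitInterval × unitInterval => (h p.1 (T p.2)).re) '' C := by
    refine (hC.image _ (Complex.continuous_re.comp hhc).continuousOn).ordConnected.uIcc_subset
      ⟨_, hτ₁, rfl⟩ ⟨_, hτ₀, rfl⟩ ?_
    simpa [he] using hwre
  have hsq1 := hsq w hw
  have hsq2 := hsq _ (hρ p hp)
  simp only at hpre
  rw [hpre] at hsq2
  have him : (h p.1 (T p.2)).im = w.im ∨ (h p.1 (T p.2)).im = -w.im :=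
    sq_eq_sq_iff_eq_or_eq_neg.1 (by linarith)
  have hp0 : 0 < (p.1 : ℝ) := by
    refine lt_of_le_of_ne p.1.2.1 fun h00 => ?_
    have := (hreal _ (hT p.2)).1
    rw [h00] at this
    have hw0 : w.im = 0 := by rcases him with h | h <;> linarith
    simp [hw0] at hwi
  have hpD := hmem _ (hT p.2) _ ⟨hp0, p.1.2.2⟩
  have := hD _ hpD
  have him' : (h p.1 (T p.2)).im = w.im := by
    refine him.resolve_right fun h => ?_
    rw [h] at this
    linarith
  rw [← Complex.ext hpre him']
  exact hpD

/-- Along an end `𝓕` of the parameter interval, the curves `h s`, `0 ≤ s ≤ 1`, approach an end of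
the real interval on the side `ε = ±1` of the real point `c`, uniformly in `s` and inside `D` for
`s > 0`. The distance to `c` tends to `0` if the end is the point `c` (then `N = 𝓝[>] 0`), to
infinity if the end is infinite (then `N = atTop`). -/
structure EndDeformation (D : Set ℂ) (ε c : ℝ) (N 𝓕 : Filter ℝ) (h : ℝ → ℝ → ℂ) : Prop where
  neBot : 𝓕.NeBot
  ordConnected : ∀ S ∈ 𝓕, ∃ T ∈ 𝓕, T.OrdConnected ∧ T ⊆ S
  continuousOn : ∃ S ∈ 𝓕, ContinuousOn (Function.uncurry h) (Icc 0 1 ×ˢ S)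
  real : ∀ᶠ t in 𝓕, (h 0 t).im = 0 ∧ 0 < ε * ((h 0 t).re - c)
  mem : ∀ᶠ t in 𝓕, ∀ s ∈ Ioc (0 : ℝ) 1, h s t ∈ D
  tendsto : Tendsto (fun p : ℝ × ℝ => ‖h p.1 p.2 - c‖) (𝓟 (Icc 0 1) ×ˢ 𝓕) N

/-- Every small (at an infinite end: large) circle about `c` contains a crosscut: for parameters
`t₀`, `t₁` suitably placed in the end, all curves of the homotopy are inside the circle at one of
them and outside it at the other. -/
theorem EndDeformation.eventually_exists_crosscut {D : Set ℂ} {σ ε c : ℝ} {N 𝓕 : Filter ℝ}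
    {h : ℝ → ℝ → ℂ} (H : EndDeformation D ε c N 𝓕 h) (hε : ε = 1 ∨ ε = -1)
    (hN : N = 𝓝[>] 0 ∨ N = atTop) (hD : ∀ w ∈ D, 0 < σ * w.im) {S : Set ℝ} (hS : S ∈ 𝓕) :
    ∀ᶠ ρ in N, ∃ t ∈ S, ‖h 1 t - c‖ = ρ ∧ ∀ w : ℂ, ‖w - c‖ = ρ → 0 < σ * w.im →
      w.re ∈ uIcc (h 1 t).re (c + ε * ρ) → w ∈ D := by
  have := H.neBot
  obtain ⟨S₁, hS₁, hcont⟩ := H.continuousOn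
  obtain ⟨T, hT, hTo, hTs⟩ := H.ordConnected _
    (inter_mem (inter_mem hS hS₁) (inter_mem H.real H.mem))
  have key : ∀ t₀ ∈ T, ∀ t₁ ∈ T, ∀ ρ, (∀ s ∈ Icc (0 : ℝ) 1, ‖h s t₀ - c‖ < ρ) →
      (∀ s ∈ Icc (0 : ℝ) 1, ρ < ‖h s t₁ - c‖) →
      ∃ t ∈ S, ‖h 1 t - c‖ = ρ ∧ ∀ w : ℂ, ‖w - c‖ = ρ → 0 < σ * w.im →
      w.re ∈ uIcc (h 1 t).re (c + ε * ρ) → w ∈ D := by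
    intro t₀ ht₀ t₁ ht₁ ρ h0 h1
    have hsub := hTo.uIcc_subset ht₀ ht₁
    obtain ⟨t, ht, ht'⟩ := exists_crosscut hε
      (hcont.mono (prod_mono Subset.rfl fun t ht => (hTs (hsub ht)).1.2))
      (fun t ht => (hTs (hsub ht)).2.1) (fun t ht => (hTs (hsub ht)).2.2) hD h0 h1
    exact ⟨t, (hTs (hsub ht)).1.1, ht'⟩
  have huni : ∀ U ∈ N, ∃ t ∈ T, ∀ s ∈ Icc (0 : ℝ) 1, ‖h s t - c‖ ∈ U := by
    intro U hU
    have h1 := H.tendsto hU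
    rw [mem_map, mem_prod_iff] at h1
    obtain ⟨a, ha, b, hb, hab⟩ := h1
    obtain ⟨t, htb, htT⟩ := (inter_mem hb hT : b ∩ T ∈ 𝓕) |> this.nonempty_of_mem
    exact ⟨t, htT, fun s hs => hab (mk_mem_prod (ha hs) htb)⟩
  have hbc : ∀ t ∈ T, ContinuousOn (fun s => ‖h s t - c‖) (Icc 0 1) := fun t ht =>
    ((hcont.comp (f := fun s : ℝ => (s, t)) (by fun_prop)
      fun s hs => ⟨hs, (hTs ht).1.2⟩).sub continuousOn_const).norm
  rcases hN with rfl | rfl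
  · obtain ⟨t₁, ht₁, hpos⟩ := huni _ self_mem_nhdsWithin
    obtain ⟨s₀, hs₀, hmin⟩ := isCompact_Icc.exists_isMinOn (nonempty_Icc.2 zero_le_one) (hbc t₁ ht₁)
    filter_upwards [Ioo_mem_nhdsGT (hpos s₀ hs₀)] with ρ hρ
    obtain ⟨t₀, ht₀, hlt⟩ := huni _ (Ioo_mem_nhdsGT hρ.1)
    exact key t₀ ht₀ t₁ ht₁ ρ (fun s hs => (hlt s hs).2) fun s hs => hρ.2.trans_le (hmin hs)
  · obtain ⟨t₀, ht₀⟩ := this.nonempty_of_mem hT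
    obtain ⟨s₀, hs₀, hmax⟩ := isCompact_Icc.exists_isMaxOn (nonempty_Icc.2 zero_le_one) (hbc t₀ ht₀)
    filter_upwards [eventually_gt_atTop ‖h s₀ t₀ - c‖] with ρ hρ
    obtain ⟨t₁, ht₁, hlt⟩ := huni _ (Ioi_mem_atTop ρ)
    exact key t₀ ht₀ t₁ ht₁ ρ (fun s hs => (hmax hs).trans_lt hρ) hlt

/-- The variation of a primitive along a circular crosscut: two points of a circle of radius `ρ` on
the same side of the real line are joined by an arc of length at most `πρ`. -/
theorem norm_sub_le_of_crosscut {D : Set ℂ} {σ c ρ M : ℝ} {f G : ℂ → ℂ}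
    (hσ : σ = 1 ∨ σ = -1) (hρ : 0 < ρ) (hG : ∀ w ∈ D, HasDerivAt G (f w) w)
    {w₁ w₂ : ℂ} (h₁ : ‖w₁ - c‖ = ρ) (h₂ : ‖w₂ - c‖ = ρ) (hi₁ : 0 < σ * w₁.im)
    (hi₂ : 0 < σ * w₂.im)
    (harc : ∀ w : ℂ, ‖w - c‖ = ρ → 0 < σ * w.im → w.re ∈ uIcc w₁.re w₂.re → w ∈ D)
    (hM : ∀ w ∈ D, ‖w - c‖ = ρ → ρ * ‖f w‖ ≤ M) :
    ‖G w₁ - G w₂‖ ≤ Real.pi * M := by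
  have hσ2 : σ ^ 2 = 1 := by rcases hσ with rfl | rfl <;> norm_num
  let γ : ℝ → ℂ := fun φ => c + ρ * (Real.cos φ + σ * Real.sin φ * Complex.I)
  have hre : ∀ φ, (γ φ).re = c + ρ * Real.cos φ := fun φ => by
    simp [γ, -Complex.ofReal_cos]
  have him : ∀ φ, (γ φ).im = ρ * (σ * Real.sin φ) := fun φ => by
    simp [γ, -Complex.ofReal_sin]
  have hnorm : ∀ φ, ‖γ φ - c‖ = ρ := fun φ => by
    have : ‖γ φ - c‖ ^ 2 = ρ ^ 2 := by
      rw [← Complex.normSq_eq_norm_sq, Complex.normSq_apply, Complex.sub_re, Complex.sub_im, hre,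
        him, Complex.ofReal_re, Complex.ofReal_im]
      have := Real.sin_sq_add_cos_sq φ
      linear_combination ρ ^ 2 * this + ρ ^ 2 * Real.sin φ ^ 2 * hσ2
    exact (sq_eq_sq₀ (norm_nonneg _) hρ.le).1 this
  have hpar : ∀ w : ℂ, ‖w - c‖ = ρ → 0 < σ * w.im → ∃ φ ∈ Ioo 0 Real.pi, γ φ = w := by
    intro w hw hwi
    have hsq : (w.re - c) ^ 2 + w.im ^ 2 = ρ ^ 2 := by
      rw [← hw, ← Complex.normSq_eq_norm_sq, Complex.normSq_apply]
      simp [sq]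
    have him2 : 0 < w.im ^ 2 := by
      have : w.im ≠ 0 := by rintro h; simp [h] at hwi
      positivity
    have habs : |(w.re - c) / ρ| < 1 := by
      rw [abs_div, abs_of_pos hρ, div_lt_one hρ]
      exact abs_lt_of_sq_lt_sq (by linarith) hρ.le
    obtain ⟨hlo, hhi⟩ := abs_lt.1 habs
    have hcos : Real.cos (Real.arccos ((w.re - c) / ρ)) = (w.re - c) / ρ :=
      Real.cos_arccos hlo.le hhi.le
    have hφ : Real.arccos ((w.re - c) / ρ) ∈ Ioo 0 Real.pi := by
      refine ⟨Real.arccos_pos.2 hhi, lt_of_le_of_ne (Real.arccos_le_pi _) fun h => ?_⟩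
      rw [h, Real.cos_pi] at hcos
      linarith
    have hsin := Real.sin_pos_of_pos_of_lt_pi hφ.1 hφ.2
    refine ⟨_, hφ, Complex.ext ?_ ?_⟩
    · rw [hre, hcos]; field_simp; ring
    · have h3 := hnorm (Real.arccos ((w.re - c) / ρ))
      have h4 : (γ (Real.arccos ((w.re - c) / ρ))).im ^ 2 = w.im ^ 2 := by
        have h5 : ((γ (Real.arccos ((w.re - c) / ρ))).re - c) ^ 2 +
            (γ (Real.arccos ((w.re - c) / ρ))).im ^ 2 = ρ ^ 2 := by
          rw [← h3, ← Complex.normSq_eq_norm_sq, Complex.normSq_apply, h3]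
          simp [sq]
        rw [hre, hcos] at h5
        have : c + ρ * ((w.re - c) / ρ) - c = w.re - c := by field_simp; ring
        rw [this] at h5
        linarith
      refine (sq_eq_sq_iff_eq_or_eq_neg.1 h4).resolve_right fun h => ?_
      have h6 : 0 < σ * (γ (Real.arccos ((w.re - c) / ρ))).im := by
        rw [him]
        have : σ * (ρ * (σ * Real.sin (Real.arccos ((w.re - c) / ρ)))) =
          σ ^ 2 * (ρ * Real.sin (Real.arccos ((w.re - c) / ρ))) := by ring
        rw [this, hσ2]
        positivity
      rw [h] at h6
      linarith
  obtain ⟨φ₁, hφ₁, rfl⟩ := hpar w₁ h₁ hi₁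
  obtain ⟨φ₂, hφ₂, rfl⟩ := hpar w₂ h₂ hi₂
  have hγ : ∀ φ, HasDerivAt γ (ρ * (-Real.sin φ + σ * Real.cos φ * Complex.I)) φ := fun φ => by
    have h1 := (Real.hasDerivAt_cos φ).ofReal_comp
    have h2 := (Real.hasDerivAt_sin φ).ofReal_comp
    have := ((h1.add ((h2.const_mul (σ : ℂ)).mul_const Complex.I)).const_mul (ρ : ℂ)).const_add
      (c : ℂ)
    simpa [γ] using this
  have hγn : ∀ φ : ℝ, ‖(ρ * (-Real.sin φ + σ * Real.cos φ * Complex.I) : ℂ)‖ = ρ := fun φ => by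
    have : ‖(ρ * (-Real.sin φ + σ * Real.cos φ * Complex.I) : ℂ)‖ ^ 2 = ρ ^ 2 := by
      have := Real.sin_sq_add_cos_sq φ
      rw [← Complex.normSq_eq_norm_sq, Complex.normSq_apply]
      simp only [Complex.mul_re, Complex.mul_im, Complex.add_re, Complex.add_im, Complex.neg_re,
        Complex.neg_im, Complex.ofReal_re, Complex.ofReal_im, Complex.I_re, Complex.I_im]
      linear_combination ρ ^ 2 * this + ρ ^ 2 * Real.cos φ ^ 2 * hσ2
    exact (sq_eq_sq₀ (norm_nonneg _) hρ.le).1 this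
  have hIoo : ∀ φ ∈ uIcc φ₁ φ₂, φ ∈ Ioo 0 Real.pi := fun φ hφ =>
    ordConnected_Ioo.uIcc_subset hφ₁ hφ₂ hφ
  have hD : ∀ φ ∈ uIcc φ₁ φ₂, γ φ ∈ D := by
    intro φ hφ
    have hφ' := hIoo φ hφ
    refine harc _ (hnorm φ) ?_ ?_
    · rw [him]
      have : σ * (ρ * (σ * Real.sin φ)) = σ ^ 2 * (ρ * Real.sin φ) := by ring
      rw [this, hσ2]
      have := Real.sin_pos_of_pos_of_lt_pi hφ'.1 hφ'.2
      positivity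
    · have hanti : AntitoneOn (fun φ => (γ φ).re) (Icc 0 Real.pi) := fun a ha b hb hab => by
        simp only [hre]
        have := Real.strictAntiOn_cos.antitoneOn ha hb hab
        gcongr
      exact (hanti.mono fun x hx => Ioo_subset_Icc_self (hIoo x hx)).image_uIcc_subset
        (mem_image_of_mem _ hφ)
  have := (convex_uIcc (𝕜 := ℝ) φ₁ φ₂).norm_image_sub_le_of_norm_hasDerivWithin_le (C := M)
    (f := fun φ => G (γ φ))
    (f' := fun φ => f (γ φ) * (ρ * (-Real.sin φ + σ * Real.cos φ * Complex.I)))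
    (fun φ hφ => ((hG _ (hD φ hφ)).comp_of_eq φ (hγ φ) rfl).hasDerivWithinAt)
    (fun φ hφ => by
      rw [norm_mul, hγn, mul_comm]
      exact hM _ (hD φ hφ) (hnorm φ)) right_mem_uIcc left_mem_uIcc
  have hM0 : 0 ≤ M := (by positivity : 0 ≤ ρ * ‖f (γ φ₁)‖).trans
    (hM _ (hD _ left_mem_uIcc) (hnorm _))
  refine this.trans ?_
  rw [mul_comm]
  gcongr
  rw [Real.norm_eq_abs, abs_le]
  exact ⟨by linarith [hφ₁.1, hφ₂.2], by linarith [hφ₁.2, hφ₂.1]⟩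

/-- A primitive takes nearly equal values at suitable points near the common end of two curves
homotopic to the same interval. -/
theorem EndDeformation.exists_norm_sub_le {D : Set ℂ} {σ ε c : ℝ} {N 𝓕 𝓕' : Filter ℝ}
    {h h' : ℝ → ℝ → ℂ} {f G : ℂ → ℂ} (H : EndDeformation D ε c N 𝓕 h)
    (H' : EndDeformation D ε c N 𝓕' h') (hσ : σ = 1 ∨ σ = -1) (hε : ε = 1 ∨ ε = -1)
    (hN : N = 𝓝[>] 0 ∨ N = atTop) (hD : ∀ w ∈ D, 0 < σ * w.im)
    (hG : ∀ w ∈ D, HasDerivAt G (f w) w)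
    (hf : ∀ M > 0, ∀ᶠ ρ in N, ∀ w ∈ D, ‖w - c‖ = ρ → ρ * ‖f w‖ ≤ M)
    {S S' : Set ℝ} (hS : S ∈ 𝓕) (hS' : S' ∈ 𝓕') {M : ℝ} (hM : 0 < M) :
    ∃ t ∈ S, ∃ t' ∈ S', ‖G (h 1 t) - G (h' 1 t')‖ ≤ Real.pi * M := by
  have hNpos : ∀ᶠ ρ in N, 0 < ρ := by
    rcases hN with rfl | rfl
    · exact self_mem_nhdsWithin
    · exact eventually_gt_atTop 0
  have hNb : N.NeBot := by rcases hN with rfl | rfl <;> infer_instance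
  obtain ⟨ρ, ⟨t, ⟨htS, htm⟩, htρ, ht⟩, ⟨t', ⟨htS', htm'⟩, htρ', ht'⟩, hρ, hfρ⟩ :=
    ((H.eventually_exists_crosscut hε hN hD (inter_mem hS H.mem)).and
      ((H'.eventually_exists_crosscut hε hN hD (inter_mem hS' H'.mem)).and
        (hNpos.and (hf M hM)))).exists
  have hm := htm 1 ⟨zero_lt_one, le_rfl⟩
  have hm' := htm' 1 ⟨zero_lt_one, le_rfl⟩
  refine ⟨t, htS, t', htS', norm_sub_le_of_crosscut hσ hρ hG htρ htρ' (hD _ hm) (hD _ hm')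
    (fun w hw hwi hwre => ?_) hfρ⟩
  -- the arc between the two curves is covered by their crosscuts to the real point `c + ερ`
  rcases uIcc_subset_uIcc_union_uIcc (b := c + ε * ρ) hwre with h | h
  · exact ht w hw hwi h
  · exact ht' w hw hwi (by rwa [uIcc_comm])

/-! ### Integrals along arcs -/

section Ends

theorem isOpen_ioo (a b : EReal) : IsOpen (ioo a b) :=
  (isOpen_lt continuous_const continuous_coe_real_ereal).inter
    (isOpen_lt continuous_coe_real_ereal continuous_const)

theorem ordConnected_ioo (a b : EReal) : (ioo a b).OrdConnected :=
  ⟨fun _ hx _ hy _ hz => ⟨hx.1.trans_le (EReal.coe_le_coe_iff.2 hz.1),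
    (EReal.coe_le_coe_iff.2 hz.2).trans_lt hy.2⟩⟩

theorem nonempty_ioo {a b : EReal} (h : a < b) : (ioo a b).Nonempty :=
  let ⟨x, hx⟩ := EReal.lt_iff_exists_real_btwn.1 h
  ⟨x, hx⟩

theorem ioo_mem_leftEnd {a b : EReal} (h : a < b) : ioo a b ∈ leftEnd a :=
  preimage_mem_comap (Ioo_mem_nhdsGT h)

theorem ioo_mem_rightEnd {a b : EReal} (h : a < b) : ioo a b ∈ rightEnd b :=
  preimage_mem_comap (Ioo_mem_nhdsLT h)

theorem exists_ioo_subset_of_mem_leftEnd {a : EReal} (ha : a ≠ ⊤) {S : Set ℝ}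
    (hS : S ∈ leftEnd a) : ∃ b, a < b ∧ ioo a b ⊆ S := by
  obtain ⟨U, hU, hUS⟩ := hS
  obtain ⟨b, hb, hbU⟩ := (mem_nhdsGT_iff_exists_Ioo_subset' (lt_top_iff_ne_top.2 ha)).1 hU
  exact ⟨b, hb, (preimage_mono hbU).trans hUS⟩

theorem exists_ioo_subset_of_mem_rightEnd {b : EReal} (hb : b ≠ ⊥) {S : Set ℝ}
    (hS : S ∈ rightEnd b) : ∃ a, a < b ∧ ioo a b ⊆ S := by
  obtain ⟨U, hU, hUS⟩ := hS
  obtain ⟨a, ha, haU⟩ := (mem_nhdsLT_iff_exists_Ioo_subset' (bot_lt_iff_ne_bot.2 hb)).1 hU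
  exact ⟨a, ha, (preimage_mono haU).trans hUS⟩

theorem leftEnd_neBot {a : EReal} (ha : a ≠ ⊤) : (leftEnd a).NeBot :=
  neBot_iff.2 fun h => by
    obtain ⟨b, hab, hb⟩ := exists_ioo_subset_of_mem_leftEnd ha (S := ∅) (h ▸ mem_bot)
    exact (nonempty_ioo hab).not_subset_empty hb

theorem rightEnd_neBot {b : EReal} (hb : b ≠ ⊥) : (rightEnd b).NeBot :=
  neBot_iff.2 fun h => by
    obtain ⟨a, hab, ha⟩ := exists_ioo_subset_of_mem_rightEnd hb (S := ∅) (h ▸ mem_bot)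
    exact (nonempty_ioo hab).not_subset_empty ha

instance (a : EReal) : (leftEnd a).IsCountablyGenerated := by
  unfold leftEnd; infer_instance

instance (a : EReal) : (rightEnd a).IsCountablyGenerated := by
  unfold rightEnd; infer_instance

/-- An integral over an interval is the limit of the integrals over its compact subintervals. -/
theorem tendsto_intervalIntegral_ioo {E : Type*} [NormedAddCommGroup E] [NormedSpace ℝ E]
    {a b : EReal} (hab : a < b) {g : ℝ → E} (hg : IntegrableOn g (ioo a b)) :
    Tendsto (fun p : ℝ × ℝ => ∫ t in p.1..p.2, g t) (leftEnd a ×ˢ rightEnd b)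
      (𝓝 (∫ t in ioo a b, g t)) := by
  have hlt : ∀ t ∈ ioo a b, (∀ᶠ s in leftEnd a, s < t) ∧ ∀ᶠ s in rightEnd b, t < s := fun t ht =>
    ⟨mem_of_superset (ioo_mem_leftEnd ht.1) fun s hs => EReal.coe_lt_coe_iff.1 hs.2,
      mem_of_superset (ioo_mem_rightEnd ht.2) fun s hs => EReal.coe_lt_coe_iff.1 hs.1⟩
  have hcover : AECover (volume.restrict (ioo a b)) (leftEnd a ×ˢ rightEnd b)
      (fun p : ℝ × ℝ => Ioc p.1 p.2) := by
    refine ⟨?_, fun _ => measurableSet_Ioc⟩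
    refine (ae_restrict_iff' (isOpen_ioo a b).measurableSet).2 (Eventually.of_forall fun t ht => ?_)
    filter_upwards [(hlt t ht).1.prod_inl _, (hlt t ht).2.prod_inr _] with p h1 h2
    exact ⟨h1, h2.le⟩
  refine (hcover.integral_tendsto_of_countably_generated hg).congr' ?_
  obtain ⟨m, hm⟩ := nonempty_ioo hab
  filter_upwards [(hlt m hm).1.prod_inl _, (hlt m hm).2.prod_inr _,
    (eventually_mem_set.2 (ioo_mem_leftEnd hab)).prod_inl _,
    (eventually_mem_set.2 (ioo_mem_rightEnd hab)).prod_inr _] with p h1 h2 h3 h4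
  rw [intervalIntegral.integral_of_le (h1.trans h2).le, Measure.restrict_restrict measurableSet_Ioc,
    inter_eq_left.2 (Ioc_subset_Icc_self.trans ((ordConnected_ioo a b).out h3 h4))]

end Ends

namespace Arc

variable (Γ : Arc)

theorem isOpen_dom : IsOpen Γ.dom := isOpen_ioo _ _

theorem lipschitzOnWith : LipschitzOnWith 1 Γ.path Γ.dom := by
  intro x hx y hy
  wlog hxy : x ≤ y generalizing x y
  · rw [edist_comm, edist_comm x]
    exact this hy hx (le_of_not_ge hxy)
  have h := Γ.unitSpeed hx hy
  rw [ENNReal.coe_one, one_mul, edist_comm x, edist_dist y x, Real.dist_eq,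
    abs_of_nonneg (sub_nonneg.2 hxy)]
  rw [NNReal.coe_one, one_mul] at h
  rw [← h]
  exact eVariationOn.edist_le _ ⟨hx, left_mem_Icc.2 hxy⟩ ⟨hy, right_mem_Icc.2 hxy⟩

theorem continuousOn_path : ContinuousOn Γ.path Γ.dom := Γ.lipschitzOnWith.continuousOn

theorem norm_deriv_path_le {t : ℝ} (ht : t ∈ Γ.dom) : ‖deriv Γ.path t‖ ≤ 1 :=
  norm_deriv_le_of_lipschitzOn (Γ.isOpen_dom.mem_nhds ht) Γ.lipschitzOnWith

theorem path_mem_range {t : ℝ} (ht : t ∈ Γ.dom) : Γ.path t ∈ Γ.range := mem_image_of_mem _ ht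

variable {Γ} in
theorem continuousOn_comp_path {E : Type*} [TopologicalSpace E] {F : ℂ → E}
    (hF : ContinuousOn F Γ.range) : ContinuousOn (fun t => F (Γ.path t)) Γ.dom :=
  hF.comp Γ.continuousOn_path fun _ ht => Γ.path_mem_range ht

section Integral

variable {Γ} {H E : Type*} [NormedAddCommGroup H] [InnerProductSpace ℂ H]
  [NormedAddCommGroup E] [NormedSpace ℂ E] {K : ℂ → H →L[ℂ] H} {F : ℂ → E} {C : ℝ}

theorem aestronglyMeasurable_deriv_smul (hF : ContinuousOn F Γ.range) :
    AEStronglyMeasurable (fun t => deriv Γ.path t • F (Γ.path t)) (volume.restrict Γ.dom) :=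
  (aestronglyMeasurable_deriv Γ.path _).smul
    ((continuousOn_comp_path hF).aestronglyMeasurable Γ.isOpen_dom.measurableSet)

theorem integrableOn_norm (hKc : ContinuousOn K Γ.range) (hK : Γ.eVariation K < ⊤) :
    IntegrableOn (fun t => ‖K (Γ.path t)‖) Γ.dom := by
  refine ⟨((continuousOn_comp_path hKc).norm).aestronglyMeasurable Γ.isOpen_dom.measurableSet, ?_⟩
  refine lt_of_le_of_lt (lintegral_mono fun t => ?_) hK
  simp

theorem integral_norm_eq_variation (hKc : ContinuousOn K Γ.range) :
    ∫ t in Γ.dom, ‖K (Γ.path t)‖ = Γ.variation K :=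
  integral_norm_eq_lintegral_enorm
    ((continuousOn_comp_path hKc).aestronglyMeasurable Γ.isOpen_dom.measurableSet)

theorem norm_deriv_smul_le (hFC : ∀ μ ∈ Γ.range, ‖F μ‖ ≤ C * ‖K μ‖) {t : ℝ} (ht : t ∈ Γ.dom) :
    ‖deriv Γ.path t • F (Γ.path t)‖ ≤ C * ‖K (Γ.path t)‖ := by
  rw [norm_smul]
  calc ‖deriv Γ.path t‖ * ‖F (Γ.path t)‖ ≤ 1 * ‖F (Γ.path t)‖ := by
        gcongr; exact Γ.norm_deriv_path_le ht
    _ ≤ _ := by rw [one_mul]; exact hFC _ (Γ.path_mem_range ht)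

theorem integrableOn_deriv_smul (hKc : ContinuousOn K Γ.range) (hK : Γ.eVariation K < ⊤)
    (hF : ContinuousOn F Γ.range) (hFC : ∀ μ ∈ Γ.range, ‖F μ‖ ≤ C * ‖K μ‖) :
    IntegrableOn (fun t => deriv Γ.path t • F (Γ.path t)) Γ.dom :=
  ((integrableOn_norm hKc hK).const_mul C).mono' (aestronglyMeasurable_deriv_smul hF)
    ((ae_restrict_iff' Γ.isOpen_dom.measurableSet).2
      (Eventually.of_forall fun _ ht => norm_deriv_smul_le hFC ht))

theorem norm_integral_deriv_smul_le (hKc : ContinuousOn K Γ.range) (hK : Γ.eVariation K < ⊤)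
    (hFC : ∀ μ ∈ Γ.range, ‖F μ‖ ≤ C * ‖K μ‖) :
    ‖∫ t in Γ.dom, deriv Γ.path t • F (Γ.path t)‖ ≤ C * Γ.variation K := by
  refine (norm_integral_le_of_norm_le ((integrableOn_norm hKc hK).const_mul C)
    ((ae_restrict_iff' Γ.isOpen_dom.measurableSet).2
      (Eventually.of_forall fun _ ht => norm_deriv_smul_le hFC ht))).trans_eq ?_
  rw [integral_const_mul, integral_norm_eq_variation hKc]

end Integral

/-- The fundamental theorem of calculus along a locally rectifiable arc. The arc is differentiable
only almost everywhere, but `G ∘ Γ` is Lipschitz, hence absolutely continuous. -/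
theorem intervalIntegral_eq_sub {D : Set ℂ} (hD : IsOpen D) (hΓ : Γ.range ⊆ D) {f G : ℂ → ℂ}
    (hG : ∀ w ∈ D, HasDerivAt G (f w) w) {a b : ℝ} (ha : a ∈ Γ.dom) (hb : b ∈ Γ.dom)
    (hint : IntervalIntegrable (fun t => deriv Γ.path t • f (Γ.path t)) volume a b) :
    ∫ t in a..b, deriv Γ.path t • f (Γ.path t) = G (Γ.path b) - G (Γ.path a) := by
  have hsub : uIcc a b ⊆ Γ.dom := (ordConnected_ioo _ _).uIcc_subset ha hb
  have hmem : ∀ t ∈ uIcc a b, Γ.path t ∈ D := fun t ht => hΓ (Γ.path_mem_range (hsub ht))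
  have hlip : ∃ C, LipschitzOnWith C (fun t => G (Γ.path t)) (uIcc a b) := by
    refine LocallyLipschitzOn.exists_lipschitzOnWith_of_compact isCompact_uIcc fun t ht => ?_
    have hGd : DifferentiableOn ℂ G D := fun w hw =>
      (hG w hw).differentiableAt.differentiableWithinAt
    obtain ⟨C, u, hu, hC⟩ := (hGd.analyticAt (hD.mem_nhds (hmem t ht))).contDiffAt
      (n := 1) |>.exists_lipschitzOnWith
    refine ⟨C * 1, Γ.path ⁻¹' u ∩ uIcc a b, ?_, ?_⟩
    · exact inter_mem (((Γ.continuousOn_path t (hsub ht)).mono hsub) hu) self_mem_nhdsWithin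
    · exact hC.comp (Γ.lipschitzOnWith.mono (inter_subset_right.trans hsub)) inter_subset_left
  obtain ⟨C, hC⟩ := hlip
  have hae : ∀ᵐ t, t ∈ uIcc a b → DifferentiableAt ℝ Γ.path t := by
    filter_upwards [Γ.lipschitzOnWith.ae_differentiableWithinAt_of_mem_real] with t ht htab
    exact (ht (hsub htab)).differentiableAt (Γ.isOpen_dom.mem_nhds (hsub htab))
  have hder : ∀ t ∈ uIcc a b, DifferentiableAt ℝ Γ.path t →
      HasDerivAt (fun t => G (Γ.path t)) (deriv Γ.path t • f (Γ.path t)) t := fun t ht hd => by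
    have := (hG _ (hmem t ht)).comp_of_eq t hd.hasDerivAt rfl
    rwa [mul_comm] at this
  -- absolute continuity is available for real-valued functions, so take real and imaginary parts
  have key : ∀ L : ℂ →L[ℝ] ℝ, L (∫ t in a..b, deriv Γ.path t • f (Γ.path t)) =
      L (G (Γ.path b) - G (Γ.path a)) := fun L => by
    have hac := (L.lipschitz.lipschitzOnWith (s := univ)).comp hC (mapsTo_univ _ _)
      |>.absolutelyContinuousOnInterval
    rw [← L.intervalIntegral_comp_comm hint, map_sub]
    refine Eq.trans ?_ hac.integral_deriv_eq_sub
    refine intervalIntegral.integral_congr_ae ?_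
    filter_upwards [hae] with t ht htab
    have htab' := uIoc_subset_uIcc htab
    have := L.hasFDerivAt.comp_hasDerivAt t (hder t htab' (ht htab'))
    exact this.deriv.symm
  exact Complex.ext (key Complex.reCLM) (key Complex.imCLM)

end Arc

/-! ### Deformation of integrals along arcs -/

namespace Arc

/-- Deformation invariance of contour integrals. The primitives of `f` take nearly equal values on
both arcs near each of the common ends, because the ends are joined by crosscuts on which `f` is
small. -/
theorem setIntegral_eq_of_endDeformation {Γ Γ' : Arc} {D : Set ℂ} (hDo : IsOpen D)
    (hDs : IsSimplyConnected D) {σ : ℝ} (hσ : σ = 1 ∨ σ = -1) (hD : ∀ w ∈ D, 0 < σ * w.im)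
    (hΓ : Γ.range ⊆ D) (hΓ' : Γ'.range ⊆ D) {f : ℂ → ℂ} (hf : DifferentiableOn ℂ f D)
    (hint : IntegrableOn (fun t => deriv Γ.path t • f (Γ.path t)) Γ.dom)
    (hint' : IntegrableOn (fun t => deriv Γ'.path t • f (Γ'.path t)) Γ'.dom)
    {h h' : ℝ → ℝ → ℂ} (h1 : ∀ t ∈ Γ.dom, h 1 t = Γ.path t)
    (h1' : ∀ t ∈ Γ'.dom, h' 1 t = Γ'.path t) {ε₁ ε₂ c₁ c₂ : ℝ} {N₁ N₂ : Filter ℝ}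
    (hε₁ : ε₁ = 1 ∨ ε₁ = -1) (hε₂ : ε₂ = 1 ∨ ε₂ = -1)
    (hN₁ : N₁ = 𝓝[>] 0 ∨ N₁ = atTop) (hN₂ : N₂ = 𝓝[>] 0 ∨ N₂ = atTop)
    (hf₁ : ∀ M > 0, ∀ᶠ ρ in N₁, ∀ w ∈ D, ‖w - c₁‖ = ρ → ρ * ‖f w‖ ≤ M)
    (hf₂ : ∀ M > 0, ∀ᶠ ρ in N₂, ∀ w ∈ D, ‖w - c₂‖ = ρ → ρ * ‖f w‖ ≤ M)
    (H₁ : EndDeformation D ε₁ c₁ N₁ (leftEnd Γ.lo) h)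
    (H₂ : EndDeformation D ε₂ c₂ N₂ (rightEnd Γ.hi) h)
    (H₁' : EndDeformation D ε₁ c₁ N₁ (leftEnd Γ'.lo) h')
    (H₂' : EndDeformation D ε₂ c₂ N₂ (rightEnd Γ'.hi) h') :
    ∫ t in Γ.dom, deriv Γ.path t • f (Γ.path t) =
      ∫ t in Γ'.dom, deriv Γ'.path t • f (Γ'.path t) := by
  obtain ⟨G, hG⟩ := exists_primitive_of_isSimplyConnected hDo hDs hf
  have hlim : ∀ {Γ : Arc}, Γ.range ⊆ D →
      IntegrableOn (fun t => deriv Γ.path t • f (Γ.path t)) Γ.dom → ∀ δ > 0,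
      ∃ S ∈ leftEnd Γ.lo, ∃ S' ∈ rightEnd Γ.hi, S ⊆ Γ.dom ∧ S' ⊆ Γ.dom ∧
        ∀ a ∈ S, ∀ b ∈ S', ‖(G (Γ.path b) - G (Γ.path a)) -
          ∫ t in Γ.dom, deriv Γ.path t • f (Γ.path t)‖ < δ := by
    intro Γ hΓ hint δ hδ
    have := tendsto_intervalIntegral_ioo Γ.lo_lt_hi hint (Metric.ball_mem_nhds _ hδ)
    rw [mem_map, mem_prod_iff] at this
    obtain ⟨S, hS, S', hS', hSS'⟩ := this
    refine ⟨S ∩ Γ.dom, inter_mem hS (ioo_mem_leftEnd Γ.lo_lt_hi), S' ∩ Γ.dom,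
      inter_mem hS' (ioo_mem_rightEnd Γ.lo_lt_hi), inter_subset_right, inter_subset_right,
      fun a ha b hb => ?_⟩
    have hab := hSS' (mk_mem_prod ha.1 hb.1)
    have hii : IntervalIntegrable (fun t => deriv Γ.path t • f (Γ.path t)) volume a b :=
      (hint.mono_set ((ordConnected_ioo _ _).uIcc_subset ha.2 hb.2)).intervalIntegrable
    rw [mem_preimage, Metric.mem_ball, dist_eq_norm,
      Γ.intervalIntegral_eq_sub hDo hΓ hG ha.2 hb.2 hii] at hab
    exact hab
  refine eq_of_forall_dist_le fun δ hδ => ?_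
  obtain ⟨S₁, hS₁, S₂, hS₂, hd₁, hd₂, hS⟩ := hlim hΓ hint (δ / 4) (by positivity)
  obtain ⟨S₁', hS₁', S₂', hS₂', hd₁', hd₂', hS'⟩ := hlim hΓ' hint' (δ / 4) (by positivity)
  have hM : 0 < δ / 4 / Real.pi := by positivity
  obtain ⟨a, ha, a', ha', haa⟩ := H₁.exists_norm_sub_le H₁' hσ hε₁ hN₁ hD hG hf₁ hS₁ hS₁' hM
  obtain ⟨b, hb, b', hb', hbb⟩ := H₂.exists_norm_sub_le H₂' hσ hε₂ hN₂ hD hG hf₂ hS₂ hS₂' hM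
  rw [mul_div_cancel₀ _ Real.pi_ne_zero] at haa hbb
  rw [h1 a (hd₁ ha), h1' a' (hd₁' ha')] at haa
  rw [h1 b (hd₂ hb), h1' b' (hd₂' hb')] at hbb
  have e1 := hS a ha b hb
  have e2 := hS' a' ha' b' hb'
  rw [dist_eq_norm]
  set I := ∫ t in Γ.dom, deriv Γ.path t • f (Γ.path t)
  set I' := ∫ t in Γ'.dom, deriv Γ'.path t • f (Γ'.path t)
  calc ‖I - I'‖ = ‖-((G (Γ.path b) - G (Γ.path a)) - I) + ((G (Γ'.path b') - G (Γ'.path a')) - I')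
        + (G (Γ.path b) - G (Γ'.path b')) - (G (Γ.path a) - G (Γ'.path a'))‖ := by
        congr 1; ring
    _ ≤ δ / 4 + δ / 4 + δ / 4 + δ / 4 := by
        refine (norm_sub_le _ _).trans (add_le_add ((norm_add_le _ _).trans
          (add_le_add ((norm_add_le _ _).trans (add_le_add ?_ e2.le)) hbb)) haa)
        rw [norm_neg]; exact e1.le
    _ = δ := by ring

/-- A deformation of the interval restricts to end deformations at both ends. At a finite end these
are taken relative to the end point, at an infinite end relative to `0`, which is the value of
`EReal.toReal` there. -/
theorem IsDeformation.endDeformation {Γ : Arc} {μ₁ μ₂ : EReal} {D : Set ℂ} {σ : ℝ}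
    (hD : ∀ w ∈ D, 0 < σ * w.im) (hμ : μ₁ < μ₂) (hΓ : Γ.IsDeformation μ₁ μ₂ D) :
    ∃ h : ℝ → ℝ → ℂ, (∀ t ∈ Γ.dom, h 1 t = Γ.path t) ∧
      EndDeformation D (if μ₁ = ⊥ then -1 else 1) μ₁.toReal (if μ₁ = ⊥ then atTop else 𝓝[>] 0)
        (leftEnd Γ.lo) h ∧
      EndDeformation D (if μ₂ = ⊤ then 1 else -1) μ₂.toReal (if μ₂ = ⊤ then atTop else 𝓝[>] 0)
        (rightEnd Γ.hi) h := by
  obtain ⟨h, hcont, ⟨j, hj, hjim, h0⟩, h1, hmem, hlo, hhi⟩ := hΓ.exists_homotopy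
  have hdl : Γ.dom ∈ leftEnd Γ.lo := ioo_mem_leftEnd Γ.lo_lt_hi
  have hdr : Γ.dom ∈ rightEnd Γ.hi := ioo_mem_rightEnd Γ.lo_lt_hi
  have hjm : ∀ t ∈ Γ.dom, j t ∈ ioo μ₁ μ₂ := fun t ht => hjim ▸ mem_image_of_mem j ht
  have hlo_ne : Γ.lo ≠ ⊤ := ne_top_of_lt Γ.lo_lt_hi
  have hhi_ne : Γ.hi ≠ ⊥ := ne_bot_of_gt Γ.lo_lt_hi
  -- no curve of the homotopy passes through an end of the interval
  have hne : ∀ c : ℝ, c ∉ ioo μ₁ μ₂ → ∀ s ∈ Icc (0 : ℝ) 1, ∀ t ∈ Γ.dom, 0 < ‖h s t - c‖ := by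
    intro c hc s hs t ht
    refine norm_pos_iff.2 (sub_ne_zero.2 fun he => ?_)
    rcases hs.1.eq_or_lt with rfl | hs0
    · rw [h0 t ht, Complex.ofReal_inj] at he
      exact hc (he ▸ hjm t ht)
    · have := hD _ (hmem s ⟨hs0, hs.2⟩ t ht)
      simp [he] at this
  have hlimfin : ∀ (c : ℝ) (𝓕 : Filter ℝ), Γ.dom ∈ 𝓕 → c ∉ ioo μ₁ μ₂ →
      Tendsto (Function.uncurry h) (𝓟 (Icc 0 1) ×ˢ 𝓕) (𝓝 (c : ℂ)) →
      Tendsto (fun p : ℝ × ℝ => ‖h p.1 p.2 - c‖) (𝓟 (Icc 0 1) ×ˢ 𝓕) (𝓝[>] 0) := by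
    intro c 𝓕 h𝓕 hc ht
    refine tendsto_nhdsWithin_iff.2 ⟨?_, ?_⟩
    · have := (ht.sub_const (c : ℂ)).norm
      rwa [sub_self, norm_zero] at this
    · filter_upwards [prod_mem_prod (mem_principal_self _) h𝓕] with p hp
      exact hne c hc _ hp.1 _ hp.2
  refine ⟨h, h1, ⟨leftEnd_neBot hlo_ne, fun S hS => ?_, ⟨_, hdl, hcont⟩, ?_,
    mem_of_superset hdl fun t ht s hs => hmem s hs t ht, ?_⟩,
    ⟨rightEnd_neBot hhi_ne, fun S hS => ?_, ⟨_, hdr, hcont⟩, ?_,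
    mem_of_superset hdr fun t ht s hs => hmem s hs t ht, ?_⟩⟩
  · obtain ⟨b, hb, hbS⟩ := exists_ioo_subset_of_mem_leftEnd hlo_ne hS
    exact ⟨_, ioo_mem_leftEnd hb, ordConnected_ioo _ _, hbS⟩
  · split_ifs with hbot
    · obtain ⟨x, hx1, hx2⟩ := EReal.lt_iff_exists_real_btwn.1
        (lt_min (hμ) (by rw [hbot]; exact EReal.bot_lt_zero) : μ₁ < min μ₂ 0)
      obtain ⟨t₀, ht₀, htx⟩ : x ∈ j '' Γ.dom := hjim ▸ ⟨hx1, hx2.trans_le (min_le_left _ _)⟩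
      have hx0 : x < 0 := EReal.coe_lt_coe_iff.1 (hx2.trans_le (min_le_right _ _))
      filter_upwards [hdl, ioo_mem_leftEnd ht₀.1] with t ht htt
      have := hj ht ht₀ (EReal.coe_lt_coe_iff.1 htt.2)
      rw [h0 t ht, hbot]
      refine ⟨Complex.ofReal_im _, ?_⟩
      simp only [Complex.ofReal_re, EReal.toReal_bot]
      linarith
    · filter_upwards [hdl] with t ht
      rw [h0 t ht, one_mul, Complex.ofReal_re]
      refine ⟨Complex.ofReal_im _, sub_pos.2 (EReal.coe_lt_coe_iff.1 ?_)⟩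
      rw [EReal.coe_toReal (ne_top_of_lt hμ) hbot]
      exact (hjm t ht).1
  · split_ifs with hbot
    · rw [endNhds, if_pos (Or.inl hbot)] at hlo
      simp only [hbot, EReal.toReal_bot, Complex.ofReal_zero, sub_zero]
      exact tendsto_norm_cobounded_atTop.comp hlo
    · rw [endNhds, if_neg (by simp [hbot, ne_top_of_lt hμ])] at hlo
      refine hlimfin _ _ hdl (fun hc => hc.1.ne ?_) hlo
      rw [EReal.coe_toReal (ne_top_of_lt hμ) hbot]
  · obtain ⟨a, ha, haS⟩ := exists_ioo_subset_of_mem_rightEnd hhi_ne hS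
    exact ⟨_, ioo_mem_rightEnd ha, ordConnected_ioo _ _, haS⟩
  · split_ifs with htop
    · obtain ⟨x, hx1, hx2⟩ := EReal.lt_iff_exists_real_btwn.1
        (max_lt (hμ) (by rw [htop]; exact EReal.zero_lt_top) : max μ₁ 0 < μ₂)
      obtain ⟨t₀, ht₀, htx⟩ : x ∈ j '' Γ.dom := hjim ▸ ⟨(le_max_left _ _).trans_lt hx1, hx2⟩
      have hx0 : 0 < x := EReal.coe_lt_coe_iff.1 ((le_max_right _ _).trans_lt hx1)
      filter_upwards [hdr, ioo_mem_rightEnd ht₀.2] with t ht htt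
      have := hj ht₀ ht (EReal.coe_lt_coe_iff.1 htt.1)
      rw [h0 t ht, htop]
      refine ⟨Complex.ofReal_im _, ?_⟩
      simp only [Complex.ofReal_re, EReal.toReal_top]
      linarith
    · filter_upwards [hdr] with t ht
      rw [h0 t ht, neg_one_mul, neg_sub, Complex.ofReal_re]
      refine ⟨Complex.ofReal_im _, sub_pos.2 (EReal.coe_lt_coe_iff.1 ?_)⟩
      rw [EReal.coe_toReal htop (ne_bot_of_gt hμ)]
      exact (hjm t ht).2
  · split_ifs with htop
    · rw [endNhds, if_pos (Or.inr htop)] at hhi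
      simp only [htop, EReal.toReal_top, Complex.ofReal_zero, sub_zero]
      exact tendsto_norm_cobounded_atTop.comp hhi
    · rw [endNhds, if_neg (by simp [htop, ne_bot_of_gt hμ])] at hhi
      refine hlimfin _ _ hdr (fun hc => hc.2.ne ?_) hhi
      rw [EReal.coe_toReal htop (ne_bot_of_gt hμ)]

end Arc

/-! ### The continued density on either sheet -/

section Sheet

variable {H₁ : Type*} [NormedAddCommGroup H₁] [InnerProductSpace ℂ H₁] [CompleteSpace H₁]
  {KB : ℝ → H₁ →L[ℂ] H₁} {μ₁ μ₂ : EReal} {D : Set ℂ} {K : ℂ → H₁ →L[ℂ] H₁}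

theorem sheet_one (D : Set ℂ) : sheet D 1 = (starRingEnd ℂ) ⁻¹' D := if_pos rfl

theorem sheet_neg_one (D : Set ℂ) : sheet D (-1) = D := if_neg (by decide)

/-- The sign of the imaginary part on the sheet `D^l`. -/
def sheetSign (l : ℤˣ) : ℝ := ((l : ℤ) : ℝ)

theorem sheetSign_eq (l : ℤˣ) : sheetSign l = 1 ∨ sheetSign l = -1 := by
  rcases Int.units_eq_one_or l with rfl | rfl <;> simp [sheetSign]

theorem IsLowerDomain.isOpen_sheet (hD : IsLowerDomain μ₁ μ₂ D) (l : ℤˣ) : IsOpen (sheet D l) := by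
  rcases Int.units_eq_one_or l with rfl | rfl
  · rw [sheet_one]; exact hD.isOpen.preimage Complex.continuous_conj
  · rw [sheet_neg_one]; exact hD.isOpen

theorem IsLowerDomain.isSimplyConnected_sheet (hD : IsLowerDomain μ₁ μ₂ D) (l : ℤˣ) :
    IsSimplyConnected (sheet D l) := by
  rcases Int.units_eq_one_or l with rfl | rfl
  · rw [sheet_one]
    exact (Complex.conjCLE.toHomeomorph.isSimplyConnected_preimage).2 hD.isSimplyConnected
  · rw [sheet_neg_one]; exact hD.isSimplyConnected

theorem IsLowerDomain.sheetSign_mul_im_pos (hD : IsLowerDomain μ₁ μ₂ D) (l : ℤˣ) :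
    ∀ w ∈ sheet D l, 0 < sheetSign l * w.im := by
  rcases Int.units_eq_one_or l with rfl | rfl
  · rw [sheet_one]
    intro w hw
    have := hD.im_neg _ hw
    rw [Complex.conj_im] at this
    simpa [sheetSign] using this
  · rw [sheet_neg_one]
    intro w hw
    simpa [sheetSign] using hD.im_neg _ hw

/-- Points of either sheet have counterparts in `D`, by reflection. -/
theorem IsContinuedDerivative.exists_norm_eq (hK : IsContinuedDerivative KB μ₁ μ₂ D K) (l : ℤˣ) :
    ∀ w ∈ sheet D l, ∃ w' ∈ D, ‖K w‖ = ‖K w'‖ ∧ ∀ c : ℝ, ‖w - c‖ = ‖w' - c‖ := by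
  rcases Int.units_eq_one_or l with rfl | rfl
  · rw [sheet_one]
    refine fun w hw => ⟨_, hw, ?_, fun c => ?_⟩
    · have := hK.conj_eq _ hw
      rw [Complex.conj_conj] at this
      rw [this, LinearIsometryEquiv.norm_map]
    · rw [← Complex.norm_conj, map_sub, Complex.conj_ofReal]
  · rw [sheet_neg_one]
    exact fun w hw => ⟨w, hw, rfl, fun _ => rfl⟩

theorem IsContinuedDerivative.continuousOn_sheet (hK : IsContinuedDerivative KB μ₁ μ₂ D K)
    (l : ℤˣ) : ContinuousOn K (sheet D l) := by
  have hc := hK.continuousOn.mono subset_union_left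
  rcases Int.units_eq_one_or l with rfl | rfl
  · rw [sheet_one]
    have h1 : ContinuousOn (fun w => ContinuousLinearMap.adjoint (K ((starRingEnd ℂ) w)))
        ((starRingEnd ℂ) ⁻¹' D) :=
      ContinuousLinearMap.adjoint.continuous.comp_continuousOn
        (hc.comp Complex.continuous_conj.continuousOn fun w hw => hw)
    refine h1.congr fun w hw => ?_
    have := hK.conj_eq _ hw
    rwa [Complex.conj_conj] at this
  · rw [sheet_neg_one]; exact hc

/-- The matrix coefficient `T ↦ ⟨y, T x⟩`, as a functional on bounded operators. -/
noncomputable def matrixCoeff (x y : H₁) : (H₁ →L[ℂ] H₁) →L[ℂ] ℂ :=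
  (innerSL ℂ y).comp (ContinuousLinearMap.apply ℂ H₁ x)

omit [CompleteSpace H₁] in
theorem matrixCoeff_apply (x y : H₁) (T : H₁ →L[ℂ] H₁) : matrixCoeff x y T = inner ℂ y (T x) := rfl

theorem IsContinuedDerivative.differentiableOn_matrixCoeff
    (hK : IsContinuedDerivative KB μ₁ μ₂ D K) (hD : IsLowerDomain μ₁ μ₂ D) (l : ℤˣ) (x y : H₁) :
    DifferentiableOn ℂ (fun w => matrixCoeff x y (K w)) (sheet D l) := by
  have hd : ∀ x y : H₁, DifferentiableOn ℂ (fun w => matrixCoeff x y (K w)) D := fun x y =>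
    (matrixCoeff x y).differentiable.comp_differentiableOn hK.differentiableOn
  rcases Int.units_eq_one_or l with rfl | rfl
  · rw [sheet_one]
    intro w hw
    have h1 := ((hd y x _ hw).differentiableAt (hD.isOpen.mem_nhds hw)).conj_conj
    rw [Complex.conj_conj] at h1
    refine (h1.congr_of_eventuallyEq ?_).differentiableWithinAt
    filter_upwards [(hD.isOpen.preimage Complex.continuous_conj).mem_nhds hw] with v hv
    have := hK.conj_eq _ hv
    rw [Complex.conj_conj] at this
    rw [this, matrixCoeff_apply, ContinuousLinearMap.adjoint_inner_right]
    exact (inner_conj_symm _ _).symm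
  · rw [sheet_neg_one]; exact hd x y

/-- The continued density is bounded near a finite end of the interval. -/
theorem IsContinuedDerivative.bounded_near_finite (hK : IsContinuedDerivative KB μ₁ μ₂ D K)
    (l : ℤˣ) {c : ℝ} (hc : c ∈ closure (ioo μ₁ μ₂)) :
    ∃ C, ∀ᶠ ρ in 𝓝[>] (0 : ℝ), ∀ w ∈ sheet D l, ‖w - c‖ = ρ → ‖K w‖ ≤ C := by
  have h1 := hK.continuousOn c (Or.inr ⟨c, hc, rfl⟩)
  have h2 := (h1.norm.mono subset_union_left).eventually (eventually_le_nhds (lt_add_one ‖K c‖))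
  rw [eventually_nhdsWithin_iff] at h2
  obtain ⟨δ, hδ, hball⟩ := Metric.eventually_nhds_iff.1 h2
  refine ⟨‖K c‖ + 1, ?_⟩
  filter_upwards [Ioo_mem_nhdsGT hδ] with ρ hρ w hw hwρ
  obtain ⟨w', hw', hn, hd⟩ := hK.exists_norm_eq l w hw
  rw [hn]
  refine hball ?_ hw'
  rw [dist_eq_norm, ← hd, hwρ]
  exact hρ.2

/-- The continued density is bounded near an infinite end of the interval. -/
theorem IsContinuedDerivative.bounded_near_infinity (hK : IsContinuedDerivative KB μ₁ μ₂ D K)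
    (l : ℤˣ) (hμ : μ₁ = ⊥ ∨ μ₂ = ⊤) (c : ℝ) :
    ∃ C, ∀ᶠ ρ in atTop, ∀ w ∈ sheet D l, ‖w - c‖ = ρ → ‖K w‖ ≤ C := by
  obtain ⟨C, hC⟩ := (hK.bounded_at_infinity hμ).bound
  rw [eventually_inf_principal] at hC
  obtain ⟨R, -, hR⟩ := hasBasis_cobounded_norm.eventually_iff.1 hC
  refine ⟨C, ?_⟩
  filter_upwards [eventually_ge_atTop (R + ‖(c : ℂ)‖)] with ρ hρ w hw hwρ
  obtain ⟨w', hw', hn, hd⟩ := hK.exists_norm_eq l w hw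
  have h1 : ‖w' - c‖ ≤ ‖w'‖ + ‖(c : ℂ)‖ := norm_sub_le _ _
  rw [← hd, hwρ] at h1
  rw [hn]
  simpa using hR (show R ≤ ‖w'‖ by linarith) hw'

theorem toReal_mem_closure_left (hμ : μ₁ < μ₂) (h : μ₁ ≠ ⊥) :
    μ₁.toReal ∈ closure (ioo μ₁ μ₂) := by
  have hco := EReal.coe_toReal (ne_top_of_lt hμ) h
  refine Metric.mem_closure_iff.2 fun ε hε => ?_
  have h1 : μ₁ < min μ₂ ((μ₁.toReal + ε : ℝ) : EReal) := by
    refine lt_min hμ ?_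
    nth_rw 1 [← hco]
    exact EReal.coe_lt_coe_iff.2 (lt_add_of_pos_right _ hε)
  obtain ⟨x, hx1, hx2⟩ := EReal.lt_iff_exists_real_btwn.1 h1
  refine ⟨x, ⟨hx1, hx2.trans_le (min_le_left _ _)⟩, ?_⟩
  have h2 : x < μ₁.toReal + ε := EReal.coe_lt_coe_iff.1 (hx2.trans_le (min_le_right _ _))
  rw [← hco] at hx1
  have h3 : μ₁.toReal < x := EReal.coe_lt_coe_iff.1 hx1
  rw [dist_comm, Real.dist_eq, abs_of_pos (sub_pos.2 h3)]
  linarith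

theorem toReal_mem_closure_right (hμ : μ₁ < μ₂) (h : μ₂ ≠ ⊤) :
    μ₂.toReal ∈ closure (ioo μ₁ μ₂) := by
  have hco := EReal.coe_toReal h (ne_bot_of_gt hμ)
  refine Metric.mem_closure_iff.2 fun ε hε => ?_
  have h1 : max μ₁ ((μ₂.toReal - ε : ℝ) : EReal) < μ₂ := by
    refine max_lt hμ ?_
    nth_rw 2 [← hco]
    exact EReal.coe_lt_coe_iff.2 (sub_lt_self _ hε)
  obtain ⟨x, hx1, hx2⟩ := EReal.lt_iff_exists_real_btwn.1 h1
  refine ⟨x, ⟨(le_max_left _ _).trans_lt hx1, hx2⟩, ?_⟩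
  have h2 : μ₂.toReal - ε < x := EReal.coe_lt_coe_iff.1 ((le_max_right _ _).trans_lt hx1)
  rw [← hco] at hx2
  have h3 : x < μ₂.toReal := EReal.coe_lt_coe_iff.1 hx2
  rw [Real.dist_eq, abs_of_pos (sub_pos.2 h3)]
  linarith

end Sheet

/-! ### Cauchy integrals along arcs -/

section Cauchy

namespace Arc

variable {H E : Type*} [NormedAddCommGroup H] [InnerProductSpace ℂ H]
  [NormedAddCommGroup E] [NormedSpace ℂ E] {Γ : Arc} {K : ℂ → H →L[ℂ] H} {F : ℂ → E} {C δ : ℝ}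
  {z : ℂ}

theorem continuousOn_inv_smul (hF : ContinuousOn F Γ.range) (hz : ∀ μ ∈ Γ.range, z ≠ μ) :
    ContinuousOn (fun μ => (z - μ)⁻¹ • F μ) Γ.range :=
  ((continuousOn_const.sub continuousOn_id).inv₀ fun μ hμ => sub_ne_zero.2 (hz μ hμ)).smul hF

theorem norm_inv_smul_le (hδ : 0 < δ) (hz : ∀ μ ∈ Γ.range, δ ≤ ‖z - μ‖)
    (hFC : ∀ μ ∈ Γ.range, ‖F μ‖ ≤ C * ‖K μ‖) :
    ∀ μ ∈ Γ.range, ‖(z - μ)⁻¹ • F μ‖ ≤ δ⁻¹ * C * ‖K μ‖ := fun μ hμ => by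
  rw [norm_smul, norm_inv, mul_assoc]
  have := hz μ hμ
  exact mul_le_mul (inv_anti₀ hδ this) (hFC μ hμ) (norm_nonneg _) (by positivity)

theorem ne_of_le_norm_sub (hδ : 0 < δ) (hz : ∀ μ ∈ Γ.range, δ ≤ ‖z - μ‖) :
    ∀ μ ∈ Γ.range, z ≠ μ := fun μ hμ h => by
  have := hz μ hμ
  rw [h, sub_self, norm_zero] at this
  exact this.not_gt hδ

/-- Cauchy integrals along `Γ` may be differentiated under the integral sign away from `Γ`. -/
theorem differentiableAt_cauchy (hKc : ContinuousOn K Γ.range) (hK : Γ.eVariation K < ⊤)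
    (hF : ContinuousOn F Γ.range) (hFC : ∀ μ ∈ Γ.range, ‖F μ‖ ≤ C * ‖K μ‖) (hδ : 0 < δ)
    (hz : ∀ μ ∈ Γ.range, δ ≤ ‖z - μ‖) :
    DifferentiableAt ℂ (fun z => ∫ t in Γ.dom, deriv Γ.path t • (z - Γ.path t)⁻¹ • F (Γ.path t))
      z := by
  have hball : ∀ w ∈ Metric.ball z (δ / 2), ∀ μ ∈ Γ.range, δ / 2 ≤ ‖w - μ‖ := fun w hw μ hμ => by
    have h1 := hz μ hμ
    have h2 : ‖z - μ‖ ≤ ‖w - μ‖ + ‖w - z‖ := by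
      rw [norm_sub_rev w z, add_comm]
      exact norm_sub_le_norm_sub_add_norm_sub z w μ
    rw [Metric.mem_ball, dist_eq_norm] at hw
    linarith
  have hδ2 : 0 < δ / 2 := by positivity
  have hmem := Metric.ball_mem_nhds z hδ2
  have hz0 := hball z (Metric.mem_ball_self hδ2)
  have hF2 : ContinuousOn (fun μ => -((z - μ)⁻¹ • (z - μ)⁻¹ • F μ)) Γ.range :=
    (continuousOn_inv_smul (continuousOn_inv_smul hF (ne_of_le_norm_sub hδ2 hz0))
      (ne_of_le_norm_sub hδ2 hz0)).neg
  refine (hasDerivAt_integral_of_dominated_loc_of_deriv_le (𝕜 := ℂ)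
    (μ := volume.restrict Γ.dom)
    (F := fun z t => deriv Γ.path t • (z - Γ.path t)⁻¹ • F (Γ.path t))
    (F' := fun z t => deriv Γ.path t •
      -((z - Γ.path t)⁻¹ • (z - Γ.path t)⁻¹ • F (Γ.path t)))
    (bound := fun t => (δ / 2)⁻¹ * ((δ / 2)⁻¹ * C) * ‖K (Γ.path t)‖) hmem ?_ ?_ ?_ ?_
    ?_ ?_).2.differentiableAt
  · filter_upwards [hmem] with w hw
    exact aestronglyMeasurable_deriv_smul
      (continuousOn_inv_smul hF (ne_of_le_norm_sub hδ2 (hball w hw)))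
  · exact integrableOn_deriv_smul hKc hK (continuousOn_inv_smul hF (ne_of_le_norm_sub hδ2 hz0))
      (norm_inv_smul_le hδ2 hz0 hFC)
  · exact aestronglyMeasurable_deriv_smul hF2
  · refine (ae_restrict_iff' Γ.isOpen_dom.measurableSet).2
      (Eventually.of_forall fun t ht w hw => ?_)
    refine norm_deriv_smul_le (F := fun μ => -((w - μ)⁻¹ • (w - μ)⁻¹ • F μ)) (fun μ hμ => ?_) ht
    rw [norm_neg]
    exact norm_inv_smul_le hδ2 (hball w hw) (norm_inv_smul_le hδ2 (hball w hw) hFC) μ hμ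
  · exact (integrableOn_norm hKc hK).const_mul _
  · refine (ae_restrict_iff' Γ.isOpen_dom.measurableSet).2
      (Eventually.of_forall fun t ht w hw => ?_)
    have hne : w - Γ.path t ≠ 0 :=
      sub_ne_zero.2 (ne_of_le_norm_sub hδ2 (hball w hw) _ (Γ.path_mem_range ht))
    have h1 := (((hasDerivAt_id w).sub_const (Γ.path t)).fun_inv hne).smul_const (F (Γ.path t))
    have h2 := h1.const_smul (deriv Γ.path t)
    refine h2.congr_deriv ?_
    congr 1
    rw [smul_smul, ← neg_smul]
    congr 1
    simp only [id]
    field_simp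

theorem integrableOn_vNum (hKc : ContinuousOn K Γ.range) (hK : Γ.eVariation K < ⊤) (hδ : 0 < δ)
    (hz : ∀ μ ∈ Γ.range, δ ≤ ‖z - μ‖) :
    IntegrableOn (fun t => deriv Γ.path t • (z - Γ.path t)⁻¹ • K (Γ.path t)) Γ.dom :=
  integrableOn_deriv_smul (F := fun μ => (z - μ)⁻¹ • K μ) (C := δ⁻¹ * 1) hKc hK
    (continuousOn_inv_smul hKc (ne_of_le_norm_sub hδ hz))
    (norm_inv_smul_le hδ hz fun _ _ => (one_mul _).ge)

theorem norm_vNum_le (hKc : ContinuousOn K Γ.range) (hK : Γ.eVariation K < ⊤) (hδ : 0 < δ)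
    (hz : ∀ μ ∈ Γ.range, δ ≤ ‖z - μ‖) : ‖vNum K Γ z‖ ≤ δ⁻¹ * Γ.variation K := by
  have := norm_integral_deriv_smul_le hKc hK
    (norm_inv_smul_le hδ hz (F := K) (C := 1) fun μ _ => (one_mul _).ge)
  rwa [mul_one] at this

end Arc

end Cauchy

/-! ### The transfer function does not depend on the contour -/

section Independence

variable {H₁ : Type*} [NormedAddCommGroup H₁] [InnerProductSpace ℂ H₁] [CompleteSpace H₁]
  {KB : ℝ → H₁ →L[ℂ] H₁} {μ₁ μ₂ : EReal} {D : Set ℂ} {K : ℂ → H₁ →L[ℂ] H₁}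
  {A : H₁ →ₗ.[ℂ] H₁} {l : ℤˣ} {Γ Γ' : Arc}

theorem Arc.IsDeformation.range_subset {μ₁ μ₂ : EReal} {D : Set ℂ} {Γ : Arc}
    (hΓ : Γ.IsDeformation μ₁ μ₂ D) : Γ.range ⊆ D := by
  obtain ⟨h, -, -, h1, hmem, -⟩ := hΓ.exists_homotopy
  rintro _ ⟨t, ht, rfl⟩
  rw [← h1 t ht]
  exact hmem 1 ⟨zero_lt_one, le_rfl⟩ t ht

/-- Points on opposite sides of the real line are separated at least by the distance of one of them
to the real line. -/
theorem le_norm_sub_of_opposite {σ : ℝ} (hσ : σ = 1 ∨ σ = -1) {z w : ℂ} (hz : σ * z.im < 0)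
    (hw : 0 < σ * w.im) : |z.im| ≤ ‖z - w‖ := by
  refine le_trans ?_ (Complex.abs_im_le_norm _)
  rw [Complex.sub_im]
  rcases hσ with rfl | rfl
  · rw [abs_of_neg (by linarith : z.im < 0), abs_of_neg (by linarith)]; linarith
  · rw [abs_of_pos (by linarith : 0 < z.im), abs_of_pos (by linarith)]; linarith

/-- The difference of two Cauchy kernels decays quadratically at infinity, so that large circular
crosscuts contribute little to its integral against a bounded density; at a finite end the crosscuts
are short and the kernels bounded. -/
theorem eventually_mul_norm_le {D : Set ℂ} {σ : ℝ} (hσ : σ = 1 ∨ σ = -1)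
    (hD : ∀ w ∈ D, 0 < σ * w.im) {N : Filter ℝ} (hN : N = 𝓝[>] 0 ∨ N = atTop) {c C : ℝ} {g : ℂ → ℂ}
    (hg : ∀ᶠ ρ in N, ∀ w ∈ D, ‖w - c‖ = ρ → ‖g w‖ ≤ C) {z z' : ℂ} (hz : σ * z.im < 0)
    (hz' : σ * z'.im < 0) {M : ℝ} (hM : 0 < M) :
    ∀ᶠ ρ in N, ∀ w ∈ D, ‖w - c‖ = ρ → ρ * ‖((z - w)⁻¹ - (z' - w)⁻¹) * g w‖ ≤ M := by
  wlog hC : 0 ≤ C generalizing C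
  · exact this (C := |C|) (hg.mono fun ρ h w hw hwρ => (h w hw hwρ).trans (le_abs_self C))
      (abs_nonneg _)
  have hpos : ∀ {z : ℂ}, σ * z.im < 0 → 0 < |z.im| := fun {z} hz =>
    abs_pos.2 fun h => by simp [h] at hz
  have hdiff : ∀ w ∈ D, ‖(z - w)⁻¹ - (z' - w)⁻¹‖ = ‖z' - z‖ * (‖z - w‖⁻¹ * ‖z' - w‖⁻¹) := by
    intro w hw
    have h1 := norm_pos_iff.1 ((hpos hz).trans_le (le_norm_sub_of_opposite hσ hz (hD w hw)))
    have h2 := norm_pos_iff.1 ((hpos hz').trans_le (le_norm_sub_of_opposite hσ hz' (hD w hw)))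
    rw [← norm_inv, ← norm_inv, ← norm_mul, ← norm_mul]
    congr 1
    field_simp
    ring
  rcases hN with rfl | rfl
  · set B := ‖z' - z‖ * (|z.im|⁻¹ * |z'.im|⁻¹) * C with hB
    have hB0 : 0 ≤ B := by positivity
    filter_upwards [hg, Ioo_mem_nhdsGT (show 0 < M / (B + 1) by positivity)] with ρ hρ hρM w hw hwρ
    have h3 : ‖((z - w)⁻¹ - (z' - w)⁻¹) * g w‖ ≤ B := by
      rw [norm_mul, hdiff w hw, hB]
      have h1 := le_norm_sub_of_opposite hσ hz (hD w hw)
      have h2 := le_norm_sub_of_opposite hσ hz' (hD w hw)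
      have := hpos hz
      have := hpos hz'
      have := hρ w hw hwρ
      gcongr
    calc ρ * ‖((z - w)⁻¹ - (z' - w)⁻¹) * g w‖ ≤ M / (B + 1) * (B + 1) := by
          refine mul_le_mul hρM.2.le (h3.trans (by linarith)) (norm_nonneg _) (by positivity)
      _ = M := by field_simp
  · set B := ‖z' - z‖ * C * 4 with hB
    have hB0 : 0 ≤ B := by positivity
    filter_upwards [hg, eventually_ge_atTop (2 * ‖z - c‖), eventually_ge_atTop (2 * ‖z' - c‖),
      eventually_ge_atTop (B / M), eventually_gt_atTop 0] with ρ hρ hρ1 hρ2 hρM hρ0 w hw hwρ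
    have hfar : ∀ {z : ℂ}, 2 * ‖z - c‖ ≤ ρ → ρ / 2 ≤ ‖z - w‖ := fun {z} h => by
      have h1 : ‖w - c‖ ≤ ‖z - w‖ + ‖z - c‖ := by
        rw [norm_sub_rev z w]
        exact norm_sub_le_norm_sub_add_norm_sub w z c
      linarith
    have h1 := hfar hρ1
    have h2 := hfar hρ2
    have h3 := hρ w hw hwρ
    have hρ2' : 0 < ρ / 2 := by positivity
    rw [norm_mul, hdiff w hw]
    calc ρ * (‖z' - z‖ * (‖z - w‖⁻¹ * ‖z' - w‖⁻¹) * ‖g w‖)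
        ≤ ρ * (‖z' - z‖ * ((ρ / 2)⁻¹ * (ρ / 2)⁻¹) * C) := by gcongr
      _ = B / ρ := by rw [hB]; field_simp; ring
      _ ≤ M := by
        rw [div_le_iff₀ hM] at hρM
        rw [div_le_iff₀ hρ0]
        linarith

/-- On the side of the real line opposite to the contours, the differences of values of `V₁(z, Γ)`
do not depend on the contour. -/
theorem vNum_sub_eq (hμ : μ₁ < μ₂) (hD : IsLowerDomain μ₁ μ₂ D)
    (hK : IsContinuedDerivative KB μ₁ μ₂ D K) (hΓ : Γ.IsDeformation μ₁ μ₂ (sheet D l))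
    (hΓ' : Γ'.IsDeformation μ₁ μ₂ (sheet D l)) (hV : Γ.eVariation K < ⊤)
    (hV' : Γ'.eVariation K < ⊤) {z w : ℂ} (hz : sheetSign l * z.im < 0)
    (hw : sheetSign l * w.im < 0) :
    vNum K Γ z - vNum K Γ w = vNum K Γ' z - vNum K Γ' w := by
  have hσ := sheetSign_eq l
  have hsgn := hD.sheetSign_mul_im_pos l
  have hpos : ∀ {z : ℂ}, sheetSign l * z.im < 0 → 0 < |z.im| := fun {z} hz =>
    abs_pos.2 fun h => by simp [h] at hz
  have hfar : ∀ {Γ : Arc}, Γ.IsDeformation μ₁ μ₂ (sheet D l) → ∀ {z : ℂ},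
      sheetSign l * z.im < 0 → ∀ μ ∈ Γ.range, |z.im| ≤ ‖z - μ‖ := fun hΓ z hz μ hμ =>
    le_norm_sub_of_opposite hσ hz (hsgn μ (hΓ.range_subset hμ))
  have hint : ∀ {Γ : Arc}, Γ.IsDeformation μ₁ μ₂ (sheet D l) → Γ.eVariation K < ⊤ → ∀ {z : ℂ},
      sheetSign l * z.im < 0 →
      IntegrableOn (fun t => deriv Γ.path t • (z - Γ.path t)⁻¹ • K (Γ.path t)) Γ.dom := by
    intro Γ hΓ hV z hz
    exact Arc.integrableOn_vNum ((hK.continuousOn_sheet l).mono hΓ.range_subset) hV (hpos hz)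
      (hfar hΓ hz)
  have key : ∀ {Γ : Arc}, Γ.IsDeformation μ₁ μ₂ (sheet D l) → Γ.eVariation K < ⊤ → ∀ x y : H₁,
      IntegrableOn (fun t => deriv Γ.path t • (((z - Γ.path t)⁻¹ - (w - Γ.path t)⁻¹) *
        matrixCoeff x y (K (Γ.path t)))) Γ.dom ∧
      matrixCoeff x y (vNum K Γ z - vNum K Γ w) = ∫ t in Γ.dom, deriv Γ.path t •
        (((z - Γ.path t)⁻¹ - (w - Γ.path t)⁻¹) * matrixCoeff x y (K (Γ.path t))) := by
    intro Γ hΓ hV x y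
    have hi := (hint hΓ hV hz).sub (hint hΓ hV hw)
    have hfun : ∀ t, deriv Γ.path t • (((z - Γ.path t)⁻¹ - (w - Γ.path t)⁻¹) *
        matrixCoeff x y (K (Γ.path t))) = matrixCoeff x y
        (deriv Γ.path t • (z - Γ.path t)⁻¹ • K (Γ.path t) -
          deriv Γ.path t • (w - Γ.path t)⁻¹ • K (Γ.path t)) := fun t => by
      rw [← smul_sub, ← sub_smul, map_smul, map_smul, smul_eq_mul (_ - _)]
    simp only [hfun]
    refine ⟨(matrixCoeff x y).integrable_comp hi, ?_⟩
    have h1 := (matrixCoeff x y).integral_comp_comm hi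
    simp only [Pi.sub_apply] at h1
    rw [h1, integral_sub (hint hΓ hV hz) (hint hΓ hV hw)]
    rfl
  -- scalar contour integrals suffice: compare matrix coefficients
  ext x
  refine ext_inner_left ℂ fun y => ?_
  rw [← matrixCoeff_apply, ← matrixCoeff_apply]
  rw [(key hΓ hV x y).2, (key hΓ' hV' x y).2]
  obtain ⟨h, h1, H₁, H₂⟩ := hΓ.endDeformation hsgn hμ
  obtain ⟨h', h1', H₁', H₂'⟩ := hΓ'.endDeformation hsgn hμ
  have hmc : ∀ {C : ℝ} {N : Filter ℝ} {c : ℝ},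
      (∀ᶠ ρ in N, ∀ w ∈ sheet D l, ‖w - c‖ = ρ → ‖K w‖ ≤ C) →
      ∀ᶠ ρ in N, ∀ w ∈ sheet D l, ‖w - c‖ = ρ → ‖matrixCoeff x y (K w)‖ ≤ ‖matrixCoeff x y‖ * C :=
    fun hC => hC.mono fun ρ hρ w hw hwρ => (ContinuousLinearMap.le_opNorm _ _).trans
      (mul_le_mul_of_nonneg_left (hρ w hw hwρ) (norm_nonneg _))
  have hN₁ : (if μ₁ = ⊥ then atTop else 𝓝[>] (0 : ℝ)) = 𝓝[>] 0 ∨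
      (if μ₁ = ⊥ then atTop else 𝓝[>] (0 : ℝ)) = atTop := by split_ifs <;> simp
  have hN₂ : (if μ₂ = ⊤ then atTop else 𝓝[>] (0 : ℝ)) = 𝓝[>] 0 ∨
      (if μ₂ = ⊤ then atTop else 𝓝[>] (0 : ℝ)) = atTop := by split_ifs <;> simp
  have hC₁ : ∃ C, ∀ᶠ ρ in (if μ₁ = ⊥ then atTop else 𝓝[>] (0 : ℝ)), ∀ w ∈ sheet D l,
      ‖w - μ₁.toReal‖ = ρ → ‖K w‖ ≤ C := by
    split_ifs with hb
    · exact hK.bounded_near_infinity l (Or.inl hb) _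
    · exact hK.bounded_near_finite l (toReal_mem_closure_left hμ hb)
  have hC₂ : ∃ C, ∀ᶠ ρ in (if μ₂ = ⊤ then atTop else 𝓝[>] (0 : ℝ)), ∀ w ∈ sheet D l,
      ‖w - μ₂.toReal‖ = ρ → ‖K w‖ ≤ C := by
    split_ifs with hb
    · exact hK.bounded_near_infinity l (Or.inr hb) _
    · exact hK.bounded_near_finite l (toReal_mem_closure_right hμ hb)
  obtain ⟨C₁, hC₁⟩ := hC₁
  obtain ⟨C₂, hC₂⟩ := hC₂
  have hne : ∀ {z : ℂ}, sheetSign l * z.im < 0 → ∀ μ ∈ sheet D l, z - μ ≠ 0 := fun hz μ hμ =>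
    norm_pos_iff.1 ((hpos hz).trans_le (le_norm_sub_of_opposite hσ hz (hsgn μ hμ)))
  refine Arc.setIntegral_eq_of_endDeformation (hD.isOpen_sheet l) (hD.isSimplyConnected_sheet l)
    hσ hsgn hΓ.range_subset hΓ'.range_subset
    (f := fun μ => ((z - μ)⁻¹ - (w - μ)⁻¹) * matrixCoeff x y (K μ)) ?_ (key hΓ hV x y).1
    (key hΓ' hV' x y).1 h1 h1' ?_ ?_ hN₁ hN₂
    (fun M hM => eventually_mul_norm_le hσ hsgn hN₁ (hmc hC₁) hz hw hM)
    (fun M hM => eventually_mul_norm_le hσ hsgn hN₂ (hmc hC₂) hz hw hM) H₁ H₂ H₁' H₂'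
  · refine DifferentiableOn.mul (DifferentiableOn.sub ?_ ?_)
      (hK.differentiableOn_matrixCoeff hD l x y)
    · exact (differentiableOn_const _).sub differentiableOn_id |>.inv (hne hz)
    · exact (differentiableOn_const _).sub differentiableOn_id |>.inv (hne hw)
  · split_ifs <;> simp
  · split_ifs <;> simp

/-- On the side of the real line opposite to the contours, `V₁(z, Γ)` does not depend on the
contour: it vanishes as `z` tends to infinity along the imaginary axis. -/
theorem vNum_eq_of_opposite (hμ : μ₁ < μ₂) (hD : IsLowerDomain μ₁ μ₂ D)
    (hK : IsContinuedDerivative KB μ₁ μ₂ D K) (hΓ : Γ.IsDeformation μ₁ μ₂ (sheet D l))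
    (hΓ' : Γ'.IsDeformation μ₁ μ₂ (sheet D l)) (hV : Γ.eVariation K < ⊤)
    (hV' : Γ'.eVariation K < ⊤) {z : ℂ} (hz : sheetSign l * z.im < 0) :
    vNum K Γ z = vNum K Γ' z := by
  have hσ := sheetSign_eq l
  have hsgn := hD.sheetSign_mul_im_pos l
  have hlim : ∀ {Γ : Arc}, Γ.IsDeformation μ₁ μ₂ (sheet D l) → Γ.eVariation K < ⊤ →
      Tendsto (fun n : ℕ => vNum K Γ ⟨0, -(sheetSign l * (n + 1))⟩) atTop
        (𝓝 0) := by
    intro Γ hΓ hV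
    refine squeeze_zero_norm (a := fun n : ℕ => (n + 1 : ℝ)⁻¹ * Γ.variation K) (fun n => ?_) ?_
    · refine Arc.norm_vNum_le ((hK.continuousOn_sheet l).mono hΓ.range_subset) hV (by positivity)
        fun μ hμ => ?_
      have h1 := hsgn μ (hΓ.range_subset hμ)
      have h2 := le_norm_sub_of_opposite hσ (z := ⟨0, -(sheetSign l * (n + 1))⟩)
        (w := μ) ?_ h1
      · refine le_trans (le_of_eq ?_) h2
        have : |(n : ℝ) + 1| = n + 1 := abs_of_pos (by positivity)
        change (n : ℝ) + 1 = |-(sheetSign l * (n + 1))|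
        rw [abs_neg, abs_mul, this]
        rcases hσ with h | h <;> rw [h] <;> simp
      · have : (0 : ℝ) < n + 1 := by positivity
        change sheetSign l * -(sheetSign l * (n + 1)) < 0
        rcases hσ with h | h <;> rw [h] <;> linarith
    · have := tendsto_one_div_add_atTop_nhds_zero_nat (𝕜 := ℝ)
      simpa using this.mul_const (Γ.variation K)
  have h1 : Tendsto (fun n : ℕ => vNum K Γ z -
      vNum K Γ ⟨0, -(sheetSign l * (n + 1))⟩) atTop (𝓝 (vNum K Γ z - 0)) :=
    tendsto_const_nhds.sub (hlim hΓ hV)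
  have h2 : Tendsto (fun n : ℕ => vNum K Γ' z -
      vNum K Γ' ⟨0, -(sheetSign l * (n + 1))⟩) atTop (𝓝 (vNum K Γ' z - 0)) :=
    tendsto_const_nhds.sub (hlim hΓ' hV')
  have h3 := tendsto_nhds_unique (h1.congr fun n => vNum_sub_eq hμ hD hK hΓ hΓ' hV hV' hz ?_) h2
  · simpa using h3
  · have : (0 : ℝ) < n + 1 := by positivity
    change sheetSign l * -(sheetSign l * (n + 1)) < 0
    rcases hσ with h | h <;> rw [h] <;> linarith

/-- By analytic continuation, `V₁(z, Γ)` does not depend on the contour in a disc about a real point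
that both contours avoid. -/
theorem vNum_eq_of_mem_ball (hμ : μ₁ < μ₂) (hD : IsLowerDomain μ₁ μ₂ D)
    (hK : IsContinuedDerivative KB μ₁ μ₂ D K) (hΓ : Γ.IsDeformation μ₁ μ₂ (sheet D l))
    (hΓ' : Γ'.IsDeformation μ₁ μ₂ (sheet D l)) (hV : Γ.eVariation K < ⊤)
    (hV' : Γ'.eVariation K < ⊤) {x : ℂ} (hx : x.im = 0) {d : ℝ}
    (hd : ∀ μ ∈ Γ.range, d ≤ dist x μ) (hd' : ∀ μ ∈ Γ'.range, d ≤ dist x μ) {z : ℂ}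
    (hz : z ∈ Metric.ball x d) : vNum K Γ z = vNum K Γ' z := by
  have hdiff : ∀ {Γ : Arc}, Γ.IsDeformation μ₁ μ₂ (sheet D l) → Γ.eVariation K < ⊤ →
      (∀ μ ∈ Γ.range, d ≤ dist x μ) → DifferentiableOn ℂ (vNum K Γ) (Metric.ball x d) := by
    intro Γ hΓ hV hd w hw
    have hKc := (hK.continuousOn_sheet l).mono hΓ.range_subset
    rw [Metric.mem_ball] at hw
    refine (Arc.differentiableAt_cauchy hKc hV hKc (C := 1) (fun μ _ => (one_mul _).ge)
      (sub_pos.2 hw) fun μ hμ => ?_).differentiableWithinAt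
    have := hd μ hμ
    have h2 := dist_triangle_left x μ w
    rw [← dist_eq_norm]
    linarith
  have hd0 : 0 < d := Metric.pos_of_mem_ball hz
  -- a point of the disc on the side opposite to the contours
  set p : ℂ := x - (sheetSign l * (d / 2) : ℝ) * Complex.I
  have hσ := sheetSign_eq l
  have hp : p ∈ Metric.ball x d := by
    rw [Metric.mem_ball, dist_eq_norm, sub_sub_cancel_left, norm_neg, norm_mul, Complex.norm_I,
      mul_one, Complex.norm_real, norm_mul, Real.norm_of_nonneg (by positivity : 0 ≤ d / 2)]
    rcases hσ with h | h <;> rw [h] <;> simp <;> linarith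
  have hpim : sheetSign l * p.im < 0 := by
    have : p.im = -(sheetSign l * (d / 2)) := by simp [p, hx]
    rw [this]
    rcases hσ with h | h <;> rw [h] <;> linarith
  refine AnalyticOnNhd.eqOn_of_preconnected_of_eventuallyEq
    ((hdiff hΓ hV hd).analyticOnNhd Metric.isOpen_ball)
    ((hdiff hΓ' hV' hd').analyticOnNhd Metric.isOpen_ball) (convex_ball x d).isPreconnected hp ?_ hz
  have ho : IsOpen {w : ℂ | sheetSign l * w.im < 0} :=
    isOpen_lt (by fun_prop) continuous_const
  filter_upwards [ho.mem_nhds hpim] with w hw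
  exact vNum_eq_of_opposite hμ hD hK hΓ hΓ' hV hV' hw

end Independence

/-! ### The basic equation and the factorization for one contour -/

namespace Arc

variable {H : Type*} [NormedAddCommGroup H] [InnerProductSpace ℂ H] {Γ : Arc}
  {A : H →ₗ.[ℂ] H} {K : ℂ → H →L[ℂ] H}

theorem d₀_le_dist {z μ : ℂ} (hz : z ∈ spec A) (hμ : μ ∈ Γ.range) : Γ.d₀ A ≤ dist z μ :=
  csInf_le ⟨0, by rintro _ ⟨z, -, μ, -, rfl⟩; exact dist_nonneg⟩ ⟨z, hz, μ, hμ, rfl⟩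

theorem variation_nonneg : 0 ≤ Γ.variation K := ENNReal.toReal_nonneg

namespace SmallVariation

variable (hS : Γ.SmallVariation A K)
include hS

theorem d₀_pos : 0 < Γ.d₀ A := by
  have h1 : 0 < Γ.d₀ A ^ 2 / 4 := variation_nonneg.trans_lt hS.2
  have h2 : 0 ≤ Γ.d₀ A := Real.sInf_nonneg (by rintro _ ⟨z, -, μ, -, rfl⟩; exact dist_nonneg)
  refine h2.lt_of_ne' fun h => ?_
  rw [h] at h1
  norm_num at h1

/-- The distance between an empty spectrum and `Γ` is `0` by convention, so that small variation
excludes this case. -/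
theorem spec_nonempty : (spec A).Nonempty := by
  by_contra h
  have := hS.d₀_pos
  rw [not_nonempty_iff_eq_empty] at h
  simp [d₀, h] at this

theorem rMin_nonneg : 0 ≤ Γ.rMin A K := by
  have hd := hS.d₀_pos
  rw [rMin, sub_nonneg, Real.sqrt_le_left (by positivity)]
  have := variation_nonneg (Γ := Γ) (K := K)
  nlinarith

theorem rMin_lt : Γ.rMin A K < Γ.d₀ A / 2 :=
  sub_lt_self _ (Real.sqrt_pos.2 (sub_pos.2 hS.2))

theorem rMin_mul : Γ.rMin A K * (Γ.d₀ A - Γ.rMin A K) = Γ.variation K := by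
  have h := Real.sq_sqrt (sub_pos.2 hS.2).le
  rw [rMin]
  linear_combination -h

theorem sub_rMin_pos : 0 < Γ.d₀ A - Γ.rMin A K := by
  linarith [hS.rMin_lt, hS.d₀_pos]

theorem d₀_sub_infDist_le {z μ : ℂ} (hμ : μ ∈ Γ.range) :
    Γ.d₀ A - Metric.infDist z (spec A) ≤ ‖z - μ‖ := by
  have h1 : Γ.d₀ A ≤ Metric.infDist μ (spec A) :=
    (Metric.le_infDist hS.spec_nonempty).2 fun w hw => by rw [dist_comm]; exact d₀_le_dist hw hμ
  have h2 := Metric.infDist_le_infDist_add_dist (s := spec A) (x := μ) (y := z)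
  rw [dist_comm, dist_eq_norm] at h2
  linarith

theorem half_d₀_le {z : ℂ} (hz : Metric.infDist z (spec A) ≤ Γ.d₀ A / 2) :
    ∀ μ ∈ Γ.range, Γ.d₀ A / 2 ≤ ‖z - μ‖ := fun μ hμ => by
  linarith [hS.d₀_sub_infDist_le (z := z) hμ]

end SmallVariation

end Arc

section OneContour

variable {H : Type*} [NormedAddCommGroup H] [InnerProductSpace ℂ H] [CompleteSpace H] {Γ : Arc}
  {A : H →ₗ.[ℂ] H} {K : ℂ → H →L[ℂ] H} {X Y : H →L[ℂ] H} {z : ℂ}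

theorem norm_resolventOp_addBounded_le_of_infDist (hA : IsSelfAdjoint A)
    (hreal : ∀ w ∈ spec A, w.im = 0) (hz : ‖X‖ < Metric.infDist z (spec A)) :
    z ∉ spec (addBounded A X) ∧
      ‖resolventOp (addBounded A X) z‖ ≤ 1 / (Metric.infDist z (spec A) - ‖X‖) :=
  norm_resolventOp_addBounded_le hA hreal hz fun _ hw => Metric.infDist_le_dist_of_mem hw

theorem spec_addBounded_subset (hA : IsSelfAdjoint A) (hreal : ∀ w ∈ spec A, w.im = 0) :
    spec (addBounded A X) ⊆ specNhd A ‖X‖ := fun _ hz =>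
  not_lt.1 fun h => (norm_resolventOp_addBounded_le_of_infDist hA hreal h).1 hz

variable (hA : IsSelfAdjoint A) (hreal : ∀ w ∈ spec A, w.im = 0) (hKc : ContinuousOn K Γ.range)
  (hS : Γ.SmallVariation A K)
include hA hreal hS

theorem resolvent_on_arc (hX : ‖X‖ ≤ Γ.rMin A K) {μ : ℂ} (hμ : μ ∈ Γ.range) :
    μ ∉ spec (addBounded A X) ∧
      ‖resolventOp (addBounded A X) μ‖ ≤ 1 / (Γ.d₀ A - Γ.rMin A K) := by
  have h := hS.sub_rMin_pos
  obtain ⟨h1, h2⟩ := norm_resolventOp_addBounded_le hA hreal (X := X) (z := μ) (d := Γ.d₀ A)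
    (by linarith) fun w hw => by rw [dist_comm]; exact Arc.d₀_le_dist hw hμ
  exact ⟨h1, h2.trans (one_div_le_one_div_of_le h (by linarith))⟩

theorem continuousOn_resolvent_on_arc (hX : ‖X‖ ≤ Γ.rMin A K) :
    ContinuousOn (resolventOp (addBounded A X)) Γ.range :=
  continuousOn_resolventOp (fun _ hμ => (resolvent_on_arc hA hreal hS hX hμ).1)
    fun _ hμ => (resolvent_on_arc hA hreal hS hX hμ).2

theorem norm_mul_resolvent_le (hX : ‖X‖ ≤ Γ.rMin A K) :
    ∀ μ ∈ Γ.range, ‖K μ ∘L resolventOp (addBounded A X) μ‖ ≤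
      1 / (Γ.d₀ A - Γ.rMin A K) * ‖K μ‖ := fun μ hμ => by
  rw [mul_comm]
  exact (norm_mul_le _ _).trans
    (mul_le_mul_of_nonneg_left (resolvent_on_arc hA hreal hS hX hμ).2 (norm_nonneg _))

include hKc

theorem continuousOn_mul_resolvent (hX : ‖X‖ ≤ Γ.rMin A K) :
    ContinuousOn (fun μ => K μ ∘L resolventOp (addBounded A X) μ) Γ.range :=
  hKc.mul (continuousOn_resolvent_on_arc hA hreal hS hX)

theorem integrableOn_vOp (hX : ‖X‖ ≤ Γ.rMin A K) :
    IntegrableOn (fun t => deriv Γ.path t •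
      (K (Γ.path t) ∘L resolventOp (addBounded A X) (Γ.path t))) Γ.dom :=
  Arc.integrableOn_deriv_smul (F := fun μ => K μ ∘L resolventOp (addBounded A X) μ) hKc hS.1
    (continuousOn_mul_resolvent hA hreal hKc hS hX) (norm_mul_resolvent_le hA hreal hS hX)

theorem norm_vOp_le (hX : ‖X‖ ≤ Γ.rMin A K) : ‖vOp K Γ (addBounded A X)‖ ≤ Γ.rMin A K := by
  have h := Arc.norm_integral_deriv_smul_le (F := fun μ => K μ ∘L resolventOp (addBounded A X) μ)
    hKc hS.1 (norm_mul_resolvent_le hA hreal hS hX)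
  refine h.trans_eq ?_
  have := hS.sub_rMin_pos.ne'
  rw [← hS.rMin_mul]
  field_simp

/-- The map `X ↦ V₁(A + X, Γ)` contracts the ball of radius `r_min`, by the factor
`r_min / (d₀ - r_min) < 1`. -/
theorem norm_vOp_sub_le (hX : ‖X‖ ≤ Γ.rMin A K) (hY : ‖Y‖ ≤ Γ.rMin A K) :
    ‖vOp K Γ (addBounded A X) - vOp K Γ (addBounded A Y)‖ ≤
      Γ.rMin A K / (Γ.d₀ A - Γ.rMin A K) * ‖X - Y‖ := by
  have hpos := hS.sub_rMin_pos
  set c := 1 / (Γ.d₀ A - Γ.rMin A K) with hc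
  have hc0 : 0 < c := by positivity
  have h := Arc.norm_integral_deriv_smul_le
    (F := fun μ => K μ ∘L resolventOp (addBounded A X) μ - K μ ∘L resolventOp (addBounded A Y) μ)
    (C := c * ‖X - Y‖ * c) hKc hS.1 fun μ hμ => by
      obtain ⟨hX1, hX2⟩ := resolvent_on_arc hA hreal hS hX hμ
      obtain ⟨hY1, hY2⟩ := resolvent_on_arc hA hreal hS hY hμ
      have e := (isResolventAt_resolventOp hY1).sub_eq_of_addBounded (isResolventAt_resolventOp hX1)
      rw [← ContinuousLinearMap.comp_sub, e, mul_comm]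
      refine (norm_mul_le (K μ) _).trans (mul_le_mul_of_nonneg_left ?_ (norm_nonneg _))
      refine (norm_mul_le _ _).trans (mul_le_mul ?_ hX2 (norm_nonneg _) (by positivity))
      refine (norm_mul_le _ _).trans ?_
      rw [norm_sub_rev Y X]
      exact mul_le_mul_of_nonneg_right hY2 (norm_nonneg _)
  have e : vOp K Γ (addBounded A X) - vOp K Γ (addBounded A Y) =
      ∫ t in Γ.dom, deriv Γ.path t • (K (Γ.path t) ∘L resolventOp (addBounded A X) (Γ.path t) -
        K (Γ.path t) ∘L resolventOp (addBounded A Y) (Γ.path t)) := by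
    simp only [smul_sub]
    exact (integral_sub (integrableOn_vOp hA hreal hKc hS hX)
      (integrableOn_vOp hA hreal hKc hS hY)).symm
  rw [e]
  refine h.trans_eq ?_
  rw [← hS.rMin_mul, hc]
  field_simp

theorem existsUnique_isBasicSolution : ∃! X, IsBasicSolution A K Γ X := by
  have hpos := hS.sub_rMin_pos
  have hr := hS.rMin_nonneg
  set q := Γ.rMin A K / (Γ.d₀ A - Γ.rMin A K) with hq
  have hq0 : 0 ≤ q := by positivity
  have hq1 : q < 1 := by
    rw [hq, div_lt_one hpos]
    linarith [hS.rMin_lt]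
  let s : Set (H →L[ℂ] H) := {X | ‖X‖ ≤ Γ.rMin A K}
  have hs : IsComplete s := (isClosed_le continuous_norm continuous_const).isComplete
  have hmaps : MapsTo (fun X => vOp K Γ (addBounded A X)) s s := fun X hX =>
    norm_vOp_le hA hreal hKc hS hX
  have hcontr : ContractingWith q.toNNReal (hmaps.restrict _ s s) := by
    refine ⟨by simpa using hq1, LipschitzWith.of_dist_le_mul fun X Y => ?_⟩
    rw [Real.coe_toNNReal _ hq0, Subtype.dist_eq, Subtype.dist_eq, dist_eq_norm, dist_eq_norm]
    exact norm_vOp_sub_le hA hreal hKc hS X.2 Y.2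
  obtain ⟨X, hXs, hXf, -⟩ := hcontr.exists_fixedPoint' hs hmaps (x := 0)
    (by simpa [s] using hr) (edist_ne_top _ _)
  refine ⟨X, ⟨hXf.symm, hXs⟩, fun Y hY => ?_⟩
  have h1 := norm_vOp_sub_le hA hreal hKc hS hY.2 hXs
  have h2 : vOp K Γ (addBounded A X) = X := hXf
  rw [← hY.1, h2, ← hq] at h1
  have h3 : ‖Y - X‖ = 0 := le_antisymm (by nlinarith [norm_nonneg (Y - X)]) (norm_nonneg _)
  exact sub_eq_zero.1 (norm_eq_zero.1 h3)

omit hA hreal hKc hS in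
/-- The left factor `W(z) = 1 + ∫_Γ K'_B(μ) (z - μ)⁻¹ (A + X - μ)⁻¹ dμ` of the factorization
`M₁(z, Γ) = W(z) (A + X - z)`. -/
noncomputable def leftFactor (A : H →ₗ.[ℂ] H) (K : ℂ → H →L[ℂ] H) (Γ : Arc) (X : H →L[ℂ] H)
    (z : ℂ) : H →L[ℂ] H :=
  1 + ∫ t in Γ.dom, deriv Γ.path t • (z - Γ.path t)⁻¹ •
    (K (Γ.path t) ∘L resolventOp (addBounded A X) (Γ.path t))

/-- The factorization `M₁(z, Γ) = W(z) (A + X - z)` of the transfer function. Since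
`X = V₁(A + X, Γ)`, it comes down to the resolvent identity
`(z - μ)⁻¹ - (A + X - μ)⁻¹ = (z - μ)⁻¹ (A + X - μ)⁻¹ (A + X - z)` under the integral. -/
theorem transfer_eq_leftFactor (hX : IsBasicSolution A K Γ X) {δ : ℝ} (hδ : 0 < δ)
    (hz : ∀ μ ∈ Γ.range, δ ≤ ‖z - μ‖) (u : A.domain) :
    transfer A K Γ z u = leftFactor A K Γ X z (addBounded A X u - z • (u : H)) := by
  set v : H := addBounded A X u - z • (u : H) with hv
  have hi₁ := Arc.integrableOn_vNum hKc hS.1 hδ hz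
  have hi₂ := integrableOn_vOp hA hreal hKc hS hX.2
  have hi₃ := Arc.integrableOn_deriv_smul hKc hS.1
    (F := fun μ => (z - μ)⁻¹ • (K μ ∘L resolventOp (addBounded A X) μ))
    (Arc.continuousOn_inv_smul (continuousOn_mul_resolvent hA hreal hKc hS hX.2)
      (Arc.ne_of_le_norm_sub hδ hz))
    (Arc.norm_inv_smul_le hδ hz (norm_mul_resolvent_le hA hreal hS hX.2))
  have key : (vNum K Γ z - X) u = (leftFactor A K Γ X z - 1) v := by
    have e1 : vNum K Γ z - X = ∫ t in Γ.dom, (deriv Γ.path t • (z - Γ.path t)⁻¹ • K (Γ.path t) -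
        deriv Γ.path t • (K (Γ.path t) ∘L resolventOp (addBounded A X) (Γ.path t))) := by
      nth_rw 1 [hX.1]
      exact (integral_sub hi₁ hi₂).symm
    have hi₁₂ : IntegrableOn (fun t => deriv Γ.path t • (z - Γ.path t)⁻¹ • K (Γ.path t) -
        deriv Γ.path t • (K (Γ.path t) ∘L resolventOp (addBounded A X) (Γ.path t))) Γ.dom :=
      hi₁.sub hi₂
    rw [e1, leftFactor, add_sub_cancel_left, ContinuousLinearMap.integral_apply hi₁₂ (u : H),
      ContinuousLinearMap.integral_apply hi₃ v]
    refine setIntegral_congr_fun Γ.isOpen_dom.measurableSet fun t ht => ?_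
    have hμ := Γ.path_mem_range ht
    set μ := Γ.path t
    have hne : z - μ ≠ 0 := sub_ne_zero.2 (Arc.ne_of_le_norm_sub hδ hz μ hμ)
    have hR := isResolventAt_resolventOp (resolvent_on_arc hA hreal hS hX.2 hμ).1
    set R := resolventOp (addBounded A X) μ
    have h1 : R v = u - (z - μ) • R u := by
      have h2 : R (addBounded A X u - μ • (u : H)) = u := hR.2 u
      have h3 : v = (addBounded A X u - μ • (u : H)) - (z - μ) • (u : H) := by
        rw [hv, sub_smul]; abel
      rw [h3, map_sub, h2, map_smul]
    change deriv Γ.path t • (z - μ)⁻¹ • K μ (u : H) - deriv Γ.path t • K μ (R u) =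
      deriv Γ.path t • (z - μ)⁻¹ • K μ (R v)
    rw [h1, map_sub, map_smul, smul_sub, smul_sub, smul_smul ((z - μ)⁻¹), inv_mul_cancel₀ hne,
      one_smul]
  change (vNum K Γ z - z • ContinuousLinearMap.id ℂ H) u + A u = leftFactor A K Γ X z v
  have h4 : leftFactor A K Γ X z v = v + (leftFactor A K Γ X z - 1) v := by
    change _ = v + (leftFactor A K Γ X z v - v)
    abel
  rw [h4, ← key]
  change vNum K Γ z u - z • (u : H) + A u = (X u + A u - z • (u : H)) + (vNum K Γ z u - X u)
  abel

theorem norm_leftFactor_sub_one_le (hX : IsBasicSolution A K Γ X)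
    (hz : Metric.infDist z (spec A) ≤ Γ.d₀ A / 2) :
    ‖leftFactor A K Γ X z - 1‖ ≤ 2 * Γ.rMin A K / Γ.d₀ A := by
  have hd := hS.d₀_pos
  rw [leftFactor, add_sub_cancel_left]
  refine (Arc.norm_integral_deriv_smul_le hKc hS.1
    (F := fun μ => (z - μ)⁻¹ • (K μ ∘L resolventOp (addBounded A X) μ))
    (Arc.norm_inv_smul_le (half_pos hd) (hS.half_d₀_le hz)
      (norm_mul_resolvent_le hA hreal hS hX.2))).trans_eq ?_
  have := hS.sub_rMin_pos.ne'
  rw [← hS.rMin_mul]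
  field_simp

omit [CompleteSpace H] hA hreal hKc in
theorem two_mul_rMin_div_lt_one : 2 * Γ.rMin A K / Γ.d₀ A < 1 := by
  rw [div_lt_one hS.d₀_pos]
  linarith [hS.rMin_lt]

theorem isUnit_leftFactor (hX : IsBasicSolution A K Γ X)
    (hz : Metric.infDist z (spec A) ≤ Γ.d₀ A / 2) : IsUnit (leftFactor A K Γ X z) := by
  have h : ‖1 - leftFactor A K Γ X z‖ < 1 := by
    rw [norm_sub_rev]
    exact (norm_leftFactor_sub_one_le hA hreal hKc hS hX hz).trans_lt (two_mul_rMin_div_lt_one hS)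
  have := (Units.oneSub _ h).isUnit
  rwa [Units.val_oneSub, sub_sub_cancel] at this

theorem differentiableAt_leftFactor (hX : IsBasicSolution A K Γ X)
    (hz : Metric.infDist z (spec A) ≤ Γ.d₀ A / 2) :
    DifferentiableAt ℂ (leftFactor A K Γ X) z :=
  (Arc.differentiableAt_cauchy hKc hS.1
    (F := fun μ => K μ ∘L resolventOp (addBounded A X) μ)
    (continuousOn_mul_resolvent hA hreal hKc hS hX.2) (norm_mul_resolvent_le hA hreal hS hX.2)
    (half_pos hS.d₀_pos) (hS.half_d₀_le hz)).const_add 1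

/-- Within distance `d₀ / 2` of the spectrum of `A` the left factor is invertible, so that the
transfer function and `A + X` have the same spectrum there. -/
theorem transferSpec_inter_specNhd_eq (hX : IsBasicSolution A K Γ X) :
    transferSpec A K Γ ∩ specNhd A (Γ.d₀ A / 2) = spec (addBounded A X) := by
  have hd := hS.d₀_pos
  have hiff : ∀ z ∈ specNhd A (Γ.d₀ A / 2),
      (0 ∈ spec (transfer A K Γ z) ↔ z ∈ spec (addBounded A X)) := fun z hz =>
    mem_spec_iff_of_factor (W := leftFactor A K Γ X z) rfl
      (isUnit_leftFactor hA hreal hKc hS hX hz) fun u hu hu' => by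
        rw [zero_smul, sub_zero]
        exact transfer_eq_leftFactor hA hreal hKc hS hX (half_pos hd) (hS.half_d₀_le hz) ⟨u, hu⟩
  ext z
  refine ⟨fun ⟨h1, h2⟩ => (hiff z h2).1 h1.2, fun h => ?_⟩
  have hz : z ∈ specNhd A (Γ.d₀ A / 2) :=
    (spec_addBounded_subset hA hreal h).trans (hX.2.trans hS.rMin_lt.le)
  refine ⟨⟨fun hcl => ?_, (hiff z hz).2 h⟩, hz⟩
  obtain ⟨μ, hμ, hlt⟩ := Metric.mem_closure_iff.1 hcl _ (half_pos hd)
  rw [dist_eq_norm] at hlt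
  exact (hS.half_d₀_le hz μ hμ).not_gt hlt

end OneContour

/-! ### The operator root does not depend on the contour -/

section TwoContours

variable {H : Type*} [NormedAddCommGroup H] [InnerProductSpace ℂ H] [CompleteSpace H]
  {Γ Γ' : Arc} {A : H →ₗ.[ℂ] H} {K : ℂ → H →L[ℂ] H} {X X' : H →L[ℂ] H} {z : ℂ}

omit [CompleteSpace H] in
theorem norm_ringInverse_le {W : H →L[ℂ] H} {q : ℝ} (hW : IsUnit W) (hq : ‖W - 1‖ ≤ q)
    (hq1 : q < 1) : ‖Ring.inverse W‖ ≤ ‖(1 : H →L[ℂ] H)‖ / (1 - q) := by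
  have h1 : Ring.inverse W = 1 - Ring.inverse W * (W - 1) := by
    rw [mul_sub, Ring.inverse_mul_cancel _ hW, mul_one, sub_sub_cancel]
  have h2 : ‖Ring.inverse W‖ ≤ ‖(1 : H →L[ℂ] H)‖ + ‖Ring.inverse W‖ * q := by
    nth_rw 1 [h1]
    exact (norm_sub_le _ _).trans (add_le_add_right ((norm_mul_le _ _).trans
      (mul_le_mul_of_nonneg_left hq (norm_nonneg _))) _)
  rw [le_div_iff₀ (sub_pos.2 hq1)]
  linarith

variable (hA : IsSelfAdjoint A) (hreal : ∀ w ∈ spec A, w.im = 0)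
  (hKc : ContinuousOn K Γ.range) (hKc' : ContinuousOn K Γ'.range)
  (hS : Γ.SmallVariation A K) (hS' : Γ'.SmallVariation A K)
  (hX : IsBasicSolution A K Γ X) (hX' : IsBasicSolution A K Γ' X')
  (hd : Γ.d₀ A ≤ Γ'.d₀ A)
include hA hreal hKc hKc' hS hS' hX hX' hd

/-- Where the two factorizations describe the same transfer function, the quotient of the left
factors is `(A + X' - z) (A + X - z)⁻¹`. -/
theorem inverse_leftFactor_mul_leftFactor (hV : vNum K Γ z = vNum K Γ' z)
    (hz : Metric.infDist z (spec A) ≤ Γ.d₀ A / 2) (hzX : z ∉ spec (addBounded A X)) :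
    Ring.inverse (leftFactor A K Γ' X' z) * leftFactor A K Γ X z - 1 =
      (X' - X) * resolventOp (addBounded A X) z := by
  have hz' : Metric.infDist z (spec A) ≤ Γ'.d₀ A / 2 := by linarith
  have hR := isResolventAt_resolventOp hzX
  set R := resolventOp (addBounded A X) z
  have hW : leftFactor A K Γ X z = leftFactor A K Γ' X' z * (1 + (X' - X) * R) := by
    ext x
    obtain ⟨hx, e⟩ := hR.1 x
    let u : A.domain := ⟨R x, hx⟩
    have e₁ : addBounded A X u - z • (u : H) = x := e
    have e₂ : addBounded A X' u - z • (u : H) = x + (X' - X) u :=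
      calc addBounded A X' u - z • (u : H)
          = addBounded A X u - z • (u : H) + (X' u - X u) := by
            rw [addBounded_apply, addBounded_apply]
            abel
        _ = x + (X' - X) u := by rw [e₁]; rfl
    have h₁ := transfer_eq_leftFactor hA hreal hKc hS hX (half_pos hS.d₀_pos) (hS.half_d₀_le hz) u
    have h₂ := transfer_eq_leftFactor hA hreal hKc' hS' hX' (half_pos hS'.d₀_pos)
      (hS'.half_d₀_le hz') u
    have h₃ : transfer A K Γ z u = transfer A K Γ' z u := by
      change (vNum K Γ z - _) (u : H) + A u = (vNum K Γ' z - _) (u : H) + A u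
      rw [hV]
    rw [e₁] at h₁
    rw [e₂] at h₂
    exact h₁.symm.trans (h₃.trans h₂)
  rw [hW, ← mul_assoc, Ring.inverse_mul_cancel _ (isUnit_leftFactor hA hreal hKc' hS' hX' hz'),
    one_mul, add_sub_cancel_left]

/-- Liouville's theorem: the function `(X' - X) (A + X - z)⁻¹` continues to a bounded entire
function that tends to zero along the imaginary axis. -/
theorem basicSolution_eq_of_vNum_eq
    (hV : ∀ z, Metric.infDist z (spec A) < Γ.d₀ A → vNum K Γ z = vNum K Γ' z) : X' = X := by
  have hdp := hS.d₀_pos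
  have hr := hS.rMin_lt
  set d := Γ.d₀ A
  set r := Γ.rMin A K
  set T := addBounded A X
  -- `Q` and `P` are the two expressions for the entire function, near and away from the spectrum
  let Q : ℂ → H →L[ℂ] H := fun z =>
    Ring.inverse (leftFactor A K Γ' X' z) * leftFactor A K Γ X z - 1
  let P : ℂ → H →L[ℂ] H := fun z => (X' - X) * resolventOp T z
  have hres : ∀ z, r < Metric.infDist z (spec A) →
      z ∉ spec T ∧ ‖resolventOp T z‖ ≤ 1 / (Metric.infDist z (spec A) - r) := fun z hz => by
    obtain ⟨h1, h2⟩ := norm_resolventOp_addBounded_le_of_infDist hA hreal (hX.2.trans_lt hz)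
    exact ⟨h1, h2.trans (one_div_le_one_div_of_le (sub_pos.2 hz) (by linarith [hX.2]))⟩
  classical
  let G : ℂ → H →L[ℂ] H := fun z => if Metric.infDist z (spec A) < d / 2 then Q z else P z
  have hGQ : ∀ z, Metric.infDist z (spec A) < d / 2 → G z = Q z := fun z hz => if_pos hz
  have hGP : ∀ z, r < Metric.infDist z (spec A) → G z = P z := fun z hz => by
    by_cases h : Metric.infDist z (spec A) < d / 2
    · rw [hGQ z h]
      exact inverse_leftFactor_mul_leftFactor hA hreal hKc hKc' hS hS' hX hX' hd
        (hV z (by linarith)) h.le (hres z hz).1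
    · exact if_neg h
  have hcont : Continuous fun z : ℂ => Metric.infDist z (spec A) := Metric.continuous_infDist_pt _
  obtain ⟨r', hr', hr'd⟩ := exists_between hr
  have hdiff : Differentiable ℂ G := fun z => by
    rcases lt_or_ge (Metric.infDist z (spec A)) (d / 2) with h | h
    · have hQ : DifferentiableAt ℂ Q z :=
        (((differentiableAt_leftFactor hA hreal hKc' hS' hX' (by linarith)).inverse
          (isUnit_leftFactor hA hreal hKc' hS' hX' (by linarith))).mul
          (differentiableAt_leftFactor hA hreal hKc hS hX h.le)).sub_const 1
      exact hQ.congr_of_eventuallyEq 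
        (mem_of_superset ((isOpen_lt hcont continuous_const).mem_nhds h) hGQ)
    · have ho : IsOpen {z : ℂ | r' < Metric.infDist z (spec A)} := isOpen_lt continuous_const hcont
      have hmem : {z : ℂ | r' < Metric.infDist z (spec A)} ∈ 𝓝 z := ho.mem_nhds (hr'd.trans_le h)
      have hR := differentiableOn_resolventOp (T := T) (C := 1 / (r' - r)) ho
        (fun w hw => (hres w (hr'.trans hw)).1) fun w hw => (hres w (hr'.trans hw)).2.trans
          (one_div_le_one_div_of_le (sub_pos.2 hr') (by simpa using hw.le))
      have hP : DifferentiableAt ℂ P z := (hR.differentiableAt hmem).const_mul (X' - X)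
      exact hP.congr_of_eventuallyEq (mem_of_superset hmem fun w hw => hGP w (hr'.trans hw))
  have hPle : ∀ z, r < Metric.infDist z (spec A) →
      ‖G z‖ ≤ ‖X' - X‖ * (1 / (Metric.infDist z (spec A) - r)) := fun z hz => by
    rw [hGP z hz]
    exact (norm_mul_le _ _).trans (mul_le_mul_of_nonneg_left (hres z hz).2 (norm_nonneg _))
  have hbdd : Bornology.IsBounded (range G) := by
    set q := 2 * r / d
    set q' := 2 * Γ'.rMin A K / Γ'.d₀ A
    have hq' : q' < 1 := two_mul_rMin_div_lt_one hS'
    set N := ‖(1 : H →L[ℂ] H)‖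
    refine (Metric.isBounded_closedBall (x := (0 : H →L[ℂ] H))
      (r := max (N / (1 - q') * (N + q) + N) (‖X' - X‖ * (1 / (d / 2 - r))))).subset ?_
    rintro _ ⟨z, rfl⟩
    rw [mem_closedBall_zero_iff]
    rcases lt_or_ge (Metric.infDist z (spec A)) (d / 2) with h | h
    · refine le_max_of_le_left ?_
      have h' : Metric.infDist z (spec A) ≤ Γ'.d₀ A / 2 := by linarith
      have h1 : ‖leftFactor A K Γ X z‖ ≤ N + q := by
        have := norm_add_le (1 : H →L[ℂ] H) (leftFactor A K Γ X z - 1)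
        rw [add_sub_cancel] at this
        linarith [norm_leftFactor_sub_one_le hA hreal hKc hS hX h.le]
      have h2 := norm_ringInverse_le (isUnit_leftFactor hA hreal hKc' hS' hX' h')
        (norm_leftFactor_sub_one_le hA hreal hKc' hS' hX' h') hq'
      rw [hGQ z h]
      refine (norm_sub_le _ _).trans (add_le_add_left ((norm_mul_le _ _).trans ?_) _)
      exact mul_le_mul h2 h1 (norm_nonneg _)
        (div_nonneg (norm_nonneg _) (sub_nonneg.2 hq'.le))
    · refine le_max_of_le_right ((hPle z (by linarith)).trans ?_)
      exact mul_le_mul_of_nonneg_left (one_div_le_one_div_of_le (sub_pos.2 hr) (by linarith))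
        (norm_nonneg _)
  -- the point `i (r + t)` has distance at least `r + t` from the spectrum, which is real
  have him : ∀ t : ℝ, 0 < t → r + t ≤ Metric.infDist (((r + t : ℝ) : ℂ) * Complex.I) (spec A) :=
    fun t ht => (Metric.le_infDist hS.spec_nonempty).2 fun w hw => by
      have h := Complex.abs_im_le_norm (((r + t : ℝ) : ℂ) * Complex.I - w)
      rw [Complex.sub_im, hreal w hw, Complex.im_ofReal_mul, sub_zero] at h
      rw [dist_eq_norm]
      exact (le_abs_self _).trans (by simpa using h)
  have hzero : ∀ z, G z = 0 := fun z => by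
    have hle : ∀ t : ℝ, 0 < t → ‖G z‖ ≤ ‖X' - X‖ * (1 / t) := fun t ht => by
      rw [hdiff.apply_eq_apply_of_bounded hbdd z (((r + t : ℝ) : ℂ) * Complex.I)]
      have h := him t ht
      exact (hPle _ (by linarith)).trans (mul_le_mul_of_nonneg_left
        (one_div_le_one_div_of_le ht (by linarith)) (norm_nonneg _))
    have hlim : Tendsto (fun t : ℝ => ‖X' - X‖ * (1 / t)) atTop (𝓝 0) := by
      simpa using tendsto_inv_atTop_zero.const_mul ‖X' - X‖
    exact norm_le_zero_iff.1 (ge_of_tendsto hlim ((eventually_gt_atTop 0).mono hle))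
  have h1 := him 1 one_pos
  have hlt : r < Metric.infDist (((r + 1 : ℝ) : ℂ) * Complex.I) (spec A) := by linarith
  set z₀ : ℂ := ((r + 1 : ℝ) : ℂ) * Complex.I
  have h2 : (X' - X) * resolventOp T z₀ = 0 := (hGP z₀ hlt).symm.trans (hzero z₀)
  have hR := isResolventAt_resolventOp (hres z₀ hlt).1
  -- `X' - X` vanishes on the range of the resolvent, which is the dense domain of `A`
  refine ContinuousLinearMap.coeFn_injective
    (X'.continuous.ext_on hA.dense_domain X.continuous fun u hu => ?_)
  have h3 := congrArg (fun S : H →L[ℂ] H => S (T ⟨u, hu⟩ - z₀ • u)) h2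
  change (X' - X) (resolventOp T z₀ (T ⟨u, hu⟩ - z₀ • u)) = 0 at h3
  rw [hR.2 ⟨u, hu⟩] at h3
  exact sub_eq_zero.1 h3

end TwoContours

section Main

variable {H₁ : Type*} [NormedAddCommGroup H₁] [InnerProductSpace ℂ H₁] [CompleteSpace H₁]
  {A : H₁ →ₗ.[ℂ] H₁} {KB : ℝ → H₁ →L[ℂ] H₁} {μ₁ μ₂ : EReal} {D : Set ℂ} {K : ℂ → H₁ →L[ℂ] H₁}
  {l : ℤˣ} {Γ Γ' : Arc} {X X' : H₁ →L[ℂ] H₁}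

/-- All admissible contours have the same basic solution. Discs of radius `d₀(Γ) ≤ d₀(Γ')` about the
points of the spectrum avoid both contours. -/
theorem Admissible.basicSolution_eq (hA : IsSelfAdjoint A) (hreal : ∀ w ∈ spec A, w.im = 0)
    (hμ : μ₁ < μ₂) (hD : IsLowerDomain μ₁ μ₂ D) (hK : IsContinuedDerivative KB μ₁ μ₂ D K)
    (hΓ : Admissible A K μ₁ μ₂ D l Γ) (hΓ' : Admissible A K μ₁ μ₂ D l Γ')
    (hX : IsBasicSolution A K Γ X) (hX' : IsBasicSolution A K Γ' X') : X' = X := by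
  wlog hd : Γ.d₀ A ≤ Γ'.d₀ A generalizing Γ Γ' X X'
  · exact (this hΓ' hΓ hX' hX (le_of_not_ge hd)).symm
  refine basicSolution_eq_of_vNum_eq hA hreal ((hK.continuousOn_sheet l).mono hΓ.1.range_subset)
    ((hK.continuousOn_sheet l).mono hΓ'.1.range_subset) hΓ.2 hΓ'.2 hX hX' hd fun z hz => ?_
  obtain ⟨w, hw, hlt⟩ := (Metric.infDist_lt_iff hΓ.2.spec_nonempty).1 hz
  exact vNum_eq_of_mem_ball hμ hD hK hΓ.1 hΓ'.1 hΓ.2.1 hΓ'.2.1 (hreal w hw)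
    (fun _ hm => Arc.d₀_le_dist hw hm) (fun _ hm => hd.trans (Arc.d₀_le_dist hw hm)) hlt

end Main

end OperatorRoot

theorem mainTheorem3 {H₀ H₁ : Type*}
    [NormedAddCommGroup H₀] [InnerProductSpace ℂ H₀] [CompleteSpace H₀]
    [NormedAddCommGroup H₁] [InnerProductSpace ℂ H₁] [CompleteSpace H₁]
    (A₀ : H₀ →ₗ.[ℂ] H₀) (A₁ : H₁ →ₗ.[ℂ] H₁) (B : H₁ →L[ℂ] H₀)
    (hA₀ : IsSelfAdjoint A₀) (hA₁ : IsSelfAdjoint A₁)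
    (μ₁ μ₂ : EReal) (hμ : μ₁ < μ₂)
    (E : ProjMeasure H₀) (hE : E.IsSpectralMeasureOf A₀)
    (hac : ∀ x : H₀, E.diag x ≪ volume)
    (hσ₀ : spec A₀ = Complex.ofReal '' closure (ioo μ₁ μ₂))
    (hσ₁ : spec A₁ ⊆ Complex.ofReal '' ioo μ₁ μ₂)
    (D : Set ℂ) (hD : IsLowerDomain μ₁ μ₂ D)
    (K : ℂ → H₁ →L[ℂ] H₁)
    (hK : IsContinuedDerivative (couplingMeasure B E) μ₁ μ₂ D K)
    (l : ℤˣ) (hΓ : ∃ Γ : Arc, Admissible A₁ K μ₁ μ₂ D l Γ) :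
    ∃ X : H₁ →L[ℂ] H₁,
      (∀ Γ : Arc, Admissible A₁ K μ₁ μ₂ D l Γ →
        ∀ Y : H₁ →L[ℂ] H₁, IsBasicSolution A₁ K Γ Y ↔ Y = X) ∧
      spec (addBounded A₁ X) ⊆ specNhd A₁ (r₀ A₁ K μ₁ μ₂ D l) ∧
      ∀ Γ : Arc, Admissible A₁ K μ₁ μ₂ D l Γ →
        transferSpec A₁ K Γ ∩ specNhd A₁ (Γ.d₀ A₁ / 2) = spec (addBounded A₁ X) := by
  have hreal : ∀ w ∈ spec A₁, w.im = 0 := fun w hw => by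
    obtain ⟨t, -, rfl⟩ := hσ₁ hw
    exact Complex.ofReal_im t
  have hKc : ∀ Γ : Arc, Admissible A₁ K μ₁ μ₂ D l Γ → ContinuousOn K Γ.range := fun Γ h =>
    (hK.continuousOn_sheet l).mono h.1.range_subset
  have hex := fun Γ (h : Admissible A₁ K μ₁ μ₂ D l Γ) =>
    existsUnique_isBasicSolution hA₁ hreal (hKc Γ h) h.2
  obtain ⟨Γ₀, hΓ₀⟩ := hΓ
  obtain ⟨X, hX, -⟩ := hex Γ₀ hΓ₀
  have hall : ∀ Γ : Arc, Admissible A₁ K μ₁ μ₂ D l Γ → IsBasicSolution A₁ K Γ X := fun Γ h => by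
    obtain ⟨Y, hY, -⟩ := hex Γ h
    rwa [hΓ₀.basicSolution_eq hA₁ hreal hμ hD hK h hX hY] at hY
  refine ⟨X, fun Γ h Y => ⟨fun hY => (hex Γ h).unique hY (hall Γ h), fun hY => hY ▸ hall Γ h⟩,
    fun z hz => ?_, fun Γ h => transferSpec_inter_specNhd_eq hA₁ hreal (hKc Γ h) h.2 (hall Γ h)⟩
  change Metric.infDist z (spec A₁) ≤ r₀ A₁ K μ₁ μ₂ D l
  rw [r₀]
  refine le_csInf ⟨_, Γ₀, hΓ₀, rfl⟩ ?_
  rintro _ ⟨Γ, h, rfl⟩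
  exact (spec_addBounded_subset hA₁ hreal hz).trans (hall Γ h).2
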